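/- Let $P$ be an orthogonal projector on $L^2(\mathbb{R}^2)$ (complex-valued functions) with an exponentially localized kernel: there are a measurable $K:\mathbb{R}^2\times\mathbb{R}^2\to\mathbb{C}$ and constants $C,\gamma>0$ with $(P\varphi)(x)=\int K(x,y)\varphi(y)\,dy$ for all $\varphi\in L^2(\mathbb{R}^2)$ and a.e. $x$, and $|K(x,y)|\le Ce^{-\gamma|x-y|}$ for a.e. $(x,y)$. Let $s>5/2$ and let $\{\psi_\alpha\}_{\alpha\in\mathcal I}$ be an $s$-localized generalized Wannier basis for $P$ with center points $\mu_\alpha\in\mathbb{R}^2$, i.e. an orthonormal basis of $\operatorname{range}(P)$ with $\sup_\alpha\int(1+|x-\mu_\alpha|^2)^{s}|\psi_\alpha(x)|^2\,dx<\infty$. Let $m_\alpha\in\mathbb{Z}^2$ be the lattice point whose unit square $[m_1-\frac12,m_1+\frac12)\times[m_2-\frac12,m_2+\frac12)$ contains $\mu_\alpha$, and write $m_{\alpha,1}$ for its first coordinate. Let $X,Y$ be the position operators $(X\varphi)(x)=x_1\varphi(x)$, $(Y\varphi)(x)=x_2\varphi(x)$ on their maximal domains, let $Q=I-P$, and define $$\tilde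 X=\sum_{\alpha} m_{\alpha,1}\,|\psi_\alpha\rangle\langle\psi_\alpha| + QXQ .$$ Let $f:\mathbb{R}\to\mathbb{R}$ be the function with Fourier transform $\hat f(\xi)=\int f(t)e^{-i\xi t}\,dt=(1-|\xi|^2)^3$ for $|\xi|\le1$ and $\hat f(\xi)=0$ for $|\xi|\geq1$, and for $\Delta>0$ define $$\widehat X=\int_{\mathbb{R}^2} f(t_1)f(t_2)\,e^{i(Xt_1+Yt_2)/\Delta}\,\tilde X\,e^{-i(Xt_1+Yt_2)/\Delta}\,dt_1\,dt_2$$ (a strong integral). The operators $\tilde X$, $\widehat X$ and $P\widehat XP$ are taken on their natural domains. Put $G=\bigcup_{m\in\mathbb{Z}}\left(m+\tfrac14,\,m+\tfrac34\right)$. Then there is $\Delta_0>0$ such that for every $\Delta\ge\Delta_0$, the set $G$ is contained in the resolvent set $\rho(P\widehat XP)$, and $P\widehat XP$ has uniform spectral gaps: its spectrum is real and is a countable union $\bigcup_{j\in\mathcal J}\sigma_j$ for which there are constants $d>0$ and $D<\infty$ with $\operatorname{dist}(\sigma_j,\sigma_k)\ge d$ for all $j\ne k$ and $\operatorname{diam}(\sigma_j)\le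 D$ for all $j$. -/

import Mathlib

open MeasureTheory

noncomputable section

namespace Wannier

/-- The plane `ℝ²` with the Euclidean norm. -/
abbrev Plane : Type := EuclideanSpace ℝ (Fin 2)

/-- The complex Hilbert space `L²(ℝ²)` (Lebesgue measure). -/
abbrev L2 : Type := Lp ℂ 2 (volume : Measure Plane)

/-- The Japanese bracket `⟨x⟩ = √(1 + |x|²)`. -/
def bracket (x : Plane) : ℝ := Real.sqrt (1 + ‖x‖ ^ 2)

/-- `A` admits an integral kernel `K` with `|K(x, y)| ≤ C exp (-γ |x - y|)` for almost every
`(x, y)`, for some finite positive constants `C` and `γ`. -/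
def HasExpLocalizedKernel (A : L2 →L[ℂ] L2) : Prop :=
  ∃ γ : ℝ, 0 < γ ∧ ∃ K : Plane → Plane → ℂ,
    AEStronglyMeasurable (Function.uncurry K)
      ((volume : Measure Plane).prod (volume : Measure Plane)) ∧
    (∀ φ : L2, ∀ᵐ x : Plane, A φ x = ∫ y : Plane, K x y * φ y) ∧
    ∃ C : ℝ, 0 < C ∧
      ∀ᵐ p : Plane × Plane ∂((volume : Measure Plane).prod (volume : Measure Plane)),
        ‖K p.1 p.2‖ ≤ C * Real.exp (-γ * ‖p.1 - p.2‖)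

/-- The family `ψ` is an `s`-localized generalized Wannier basis for `P` with center points `c`:
it is an orthonormal basis of the range of `P`, and the moments
`∫ ⟨x - c α⟩ ^ (2 s) |ψ α (x)|² dx` are bounded uniformly in `α`. -/
structure IsLocalizedBasis {ι : Type*} (P : L2 →L[ℂ] L2) (s : ℝ) (ψ : ι → L2)
    (c : ι → Plane) : Prop where
  orthonormal : Orthonormal ℂ ψ
  span_eq : ((Submodule.span ℂ (Set.range ψ)).topologicalClosure : Set L2) = Set.range P
  localized : ∃ C : ℝ, 0 < C ∧ ∀ α : ι,
    ∫⁻ x : Plane, ENNReal.ofReal (bracket (x - c α) ^ (2 * s) * ‖ψ α x‖ ^ 2)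
      ≤ ENNReal.ofReal C

/-- The maximal domain `{φ ∈ L² : g φ ∈ L²}` of multiplication by `g`. -/
def mulDomain (g : Plane → ℂ) : Submodule ℂ L2 where
  carrier := {φ : L2 | MemLp (fun x => g x * φ x) 2 (volume : Measure Plane)}
  add_mem' := by
    intro φ χ hφ hχ
    have h : MemLp (fun x => g x * φ x + g x * χ x) 2 (volume : Measure Plane) :=
      MemLp.add hφ hχ
    refine (memLp_congr_ae ?_).2 h
    filter_upwards [Lp.coeFn_add φ χ] with x hx
    rw [hx, Pi.add_apply, mul_add]
  zero_mem' := by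
    refine (memLp_congr_ae ?_).2 (MemLp.zero : MemLp (0 : Plane → ℂ) 2 volume)
    filter_upwards [Lp.coeFn_zero ℂ 2 (volume : Measure Plane)] with x hx
    rw [hx]; simp
  smul_mem' := by
    intro a φ hφ
    have h : MemLp (fun x => a * (g x * φ x)) 2 (volume : Measure Plane) :=
      MemLp.const_mul hφ a
    refine (memLp_congr_ae ?_).2 h
    filter_upwards [Lp.coeFn_smul a φ] with x hx
    rw [hx, Pi.smul_apply, smul_eq_mul]; ring

theorem memLp_of_mulDomain (g : Plane → ℂ) (φ : mulDomain g) :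
    MemLp (fun x => g x * (φ : L2) x) 2 (volume : Measure Plane) := φ.2

/-- Multiplication by the function `g`, on its maximal domain `{φ ∈ L² : g φ ∈ L²}`. -/
def mulOp (g : Plane → ℂ) : L2 →ₗ.[ℂ] L2 where
  domain := mulDomain g
  toFun :=
    { toFun := fun φ => (memLp_of_mulDomain g φ).toLp _
      map_add' := by
        intro φ χ
        rw [← MemLp.toLp_add]
        apply MemLp.toLp_congr
        filter_upwards [Lp.coeFn_add (φ : L2) (χ : L2)] with x h1
        rw [Submodule.coe_add, h1, Pi.add_apply, Pi.add_apply, mul_add]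
      map_smul' := by
        intro a φ
        rw [RingHom.id_apply, ← MemLp.toLp_const_smul]
        apply MemLp.toLp_congr
        filter_upwards [Lp.coeFn_smul a (φ : L2)] with x h1
        rw [Submodule.coe_smul, h1, Pi.smul_apply, Pi.smul_apply, smul_eq_mul, smul_eq_mul]
        ring }

/-- The position operator `X`, `(X φ)(x) = x₁ φ(x)`. -/
def posX : L2 →ₗ.[ℂ] L2 := mulOp fun x => ((x 0 : ℝ) : ℂ)

/-- For a bounded `R` and an unbounded `A`, the operator `R A R` on its natural domain
`{φ : R φ ∈ dom A}`. -/
def sandwich (R : L2 →L[ℂ] L2) (A : L2 →ₗ.[ℂ] L2) : L2 →ₗ.[ℂ] L2 where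
  domain := A.domain.comap (R : L2 →ₗ[ℂ] L2)
  toFun :=
    { toFun := fun φ => R (A ⟨R φ, φ.2⟩)
      map_add' := by
        intro φ χ
        rw [← _root_.map_add R, ← LinearPMap.map_add]
        congr 2
        apply Subtype.ext
        simp
      map_smul' := by
        intro a φ
        rw [RingHom.id_apply, ← _root_.map_smul R, ← LinearPMap.map_smul]
        congr 2
        apply Subtype.ext
        simp }

/-- The diagonal operator `∑ α, a α |ψ α⟩⟨ψ α|`, defined at those `φ` for which the series
`∑ α, a α ⟨ψ α, φ⟩ ψ α` converges unconditionally in `L²`. -/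
def diagOp {ι : Type*} (ψ : ι → L2) (a : ι → ℂ) : L2 →ₗ.[ℂ] L2 where
  domain :=
    { carrier := {φ : L2 | Summable fun α => (a α * inner ℂ (ψ α) φ) • ψ α}
      add_mem' := by
        intro φ χ hφ hχ
        have h := Summable.add hφ hχ
        simpa only [Set.mem_ofPred_eq, inner_add_right, mul_add, add_smul] using h
      zero_mem' := by
        simp
      smul_mem' := by
        intro b φ hφ
        have h := Summable.const_smul b hφ
        simpa only [Set.mem_ofPred_eq, inner_smul_right, smul_smul, mul_left_comm] using h }
  toFun :=
    { toFun := fun φ => ∑' α, (a α * inner ℂ (ψ α) (φ : L2)) • ψ α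
      map_add' := by
        intro φ χ
        rw [← Summable.tsum_add φ.2 χ.2]
        simp only [Submodule.coe_add, inner_add_right, mul_add, add_smul]
      map_smul' := by
        intro b φ
        rw [RingHom.id_apply, ← Summable.tsum_const_smul b φ.2]
        simp only [Submodule.coe_smul, inner_smul_right, smul_smul, mul_left_comm] }

/-- The first coordinate `m₁` of the lattice point `m ∈ ℤ²` whose unit square
`[m₁ - 1/2, m₁ + 1/2) × [m₂ - 1/2, m₂ + 1/2)` contains the point `c`. -/
def latticeX (c : Plane) : ℤ := ⌊c 0 + 1 / 2⌋

/-- The operator `X̃ = ∑ m₁ |ψ⟩⟨ψ| + Q X Q` with `Q = 1 - P`, where every basis function is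
assigned to the lattice point `m` nearest to its center point. -/
def tildeX {ι : Type*} (P : L2 →L[ℂ] L2) (ψ : ι → L2) (c : ι → Plane) : L2 →ₗ.[ℂ] L2 :=
  diagOp ψ (fun α => ((latticeX (c α) : ℤ) : ℂ)) + sandwich (1 - P) posX

/-- The Fourier transform `f̂` of the filter function. -/
def filterHat (ξ : ℝ) : ℝ := if |ξ| ≤ 1 then (1 - |ξ| ^ 2) ^ 3 else 0

/-- The filter function `f`, normalized by `f̂(ξ) = ∫ f(t) exp(-i ξ t) dt`, so that `∫ f = f̂(0)`. -/
def filterFn (t : ℝ) : ℂ :=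
  (2 * Real.pi : ℂ)⁻¹ * ∫ ξ : ℝ, (filterHat ξ : ℂ) * Complex.exp (Complex.I * (ξ * t : ℝ))

theorem memLp_phase_mul (u : ℝ × ℝ) (φ : L2) :
    MemLp (fun x : Plane => Complex.exp (Complex.I * (u.1 * x 0 + u.2 * x 1 : ℝ)) * φ x) 2
      (volume : Measure Plane) := by
  refine (Lp.memLp φ).congr_norm ?_ ?_
  · refine AEStronglyMeasurable.mul ?_ (Lp.aestronglyMeasurable φ)
    apply Continuous.aestronglyMeasurable
    fun_prop
  · refine Filter.Eventually.of_forall fun x => ?_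
    rw [norm_mul, mul_comm Complex.I, Complex.norm_exp_ofReal_mul_I, one_mul]

/-- The unitary `exp(i (X u₁ + Y u₂))`: multiplication by `exp(i (x₁ u₁ + x₂ u₂))`. -/
def phase (u : ℝ × ℝ) : L2 →ₗ[ℂ] L2 where
  toFun φ := (memLp_phase_mul u φ).toLp _
  map_add' := by
    intro φ χ
    apply Lp.ext
    refine (MemLp.coeFn_toLp _).trans ?_
    filter_upwards [Lp.coeFn_add φ χ, Lp.coeFn_add
      ((memLp_phase_mul u φ).toLp _) ((memLp_phase_mul u χ).toLp _),
      MemLp.coeFn_toLp (memLp_phase_mul u φ),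
      MemLp.coeFn_toLp (memLp_phase_mul u χ)] with x h1 h2 h3 h4
    rw [h2, Pi.add_apply, h3, h4, h1, Pi.add_apply, mul_add]
  map_smul' := by
    intro a φ
    apply Lp.ext
    refine (MemLp.coeFn_toLp _).trans ?_
    filter_upwards [Lp.coeFn_smul a φ, Lp.coeFn_smul a ((memLp_phase_mul u φ).toLp _),
      MemLp.coeFn_toLp (memLp_phase_mul u φ)] with x h1 h2 h3
    simp only [RingHom.id_apply]
    rw [h2, Pi.smul_apply, h3, h1, Pi.smul_apply, smul_eq_mul, smul_eq_mul]
    ring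

/-- The integrand
`f(t₁) f(t₂) exp(i (X t₁ + Y t₂) / Δ) A exp(-i (X t₁ + Y t₂) / Δ) φ` of the filtered operator,
for a vector `φ` with `exp(-i (X t₁ + Y t₂) / Δ) φ ∈ dom A` for all `t`. -/
def filterIntegrand (A : L2 →ₗ.[ℂ] L2) (Δ : ℝ) (φ : L2)
    (h : ∀ t : ℝ × ℝ, phase (-(Δ⁻¹ • t)) φ ∈ A.domain) (t : ℝ × ℝ) : L2 :=
  (filterFn t.1 * filterFn t.2) • phase (Δ⁻¹ • t) (A ⟨phase (-(Δ⁻¹ • t)) φ, h t⟩)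

theorem filterIntegrand_add (A : L2 →ₗ.[ℂ] L2) (Δ : ℝ) (φ χ : L2) (hφ hχ h) (t : ℝ × ℝ) :
    filterIntegrand A Δ (φ + χ) h t =
      filterIntegrand A Δ φ hφ t + filterIntegrand A Δ χ hχ t := by
  have e : (⟨phase (-(Δ⁻¹ • t)) (φ + χ), h t⟩ : A.domain) =
      ⟨phase (-(Δ⁻¹ • t)) φ, hφ t⟩ + ⟨phase (-(Δ⁻¹ • t)) χ, hχ t⟩ :=
    Subtype.ext (LinearMap.map_add _ _ _)
  unfold filterIntegrand
  rw [e, LinearPMap.map_add, LinearMap.map_add, smul_add]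

theorem filterIntegrand_smul (A : L2 →ₗ.[ℂ] L2) (Δ : ℝ) (a : ℂ) (φ : L2) (hφ h) (t : ℝ × ℝ) :
    filterIntegrand A Δ (a • φ) h t = a • filterIntegrand A Δ φ hφ t := by
  have e : (⟨phase (-(Δ⁻¹ • t)) (a • φ), h t⟩ : A.domain) =
      a • ⟨phase (-(Δ⁻¹ • t)) φ, hφ t⟩ :=
    Subtype.ext (LinearMap.map_smul _ _ _)
  unfold filterIntegrand
  rw [e, LinearPMap.map_smul, LinearMap.map_smul, smul_comm a]

/-- All `φ` for which the integrand of the filtered operator is defined for every `t` and is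
Bochner integrable in `t`. -/
def filterDomain (A : L2 →ₗ.[ℂ] L2) (Δ : ℝ) : Submodule ℂ L2 where
  carrier := {φ : L2 | ∃ h : ∀ t : ℝ × ℝ, phase (-(Δ⁻¹ • t)) φ ∈ A.domain,
    Integrable (filterIntegrand A Δ φ h) (volume : Measure (ℝ × ℝ))}
  add_mem' := by
    rintro φ χ ⟨hφ, iφ⟩ ⟨hχ, iχ⟩
    refine ⟨fun t => ?_, ?_⟩
    · rw [LinearMap.map_add]
      exact A.domain.add_mem (hφ t) (hχ t)
    · exact (iφ.add iχ).congr
        (Filter.Eventually.of_forall fun t => (filterIntegrand_add A Δ φ χ hφ hχ _ t).symm)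
  zero_mem' := by
    have h0 : ∀ t : ℝ × ℝ, phase (-(Δ⁻¹ • t)) 0 ∈ A.domain := fun t => by
      rw [LinearMap.map_zero]
      exact A.domain.zero_mem
    refine ⟨h0, (integrable_zero _ _ _).congr (Filter.Eventually.of_forall fun t => ?_)⟩
    have e : (⟨phase (-(Δ⁻¹ • t)) 0, h0 t⟩ : A.domain) = 0 := Subtype.ext (LinearMap.map_zero _)
    unfold filterIntegrand
    rw [e, LinearPMap.map_zero, LinearMap.map_zero, smul_zero]
    rfl
  smul_mem' := by
    rintro a φ ⟨hφ, iφ⟩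
    refine ⟨fun t => ?_, ?_⟩
    · rw [LinearMap.map_smul]
      exact A.domain.smul_mem a (hφ t)
    · exact (iφ.smul a).congr
        (Filter.Eventually.of_forall fun t => (filterIntegrand_smul A Δ a φ hφ _ t).symm)

theorem phase_mem_of_filterDomain (A : L2 →ₗ.[ℂ] L2) (Δ : ℝ) (φ : filterDomain A Δ) :
    ∀ t : ℝ × ℝ, phase (-(Δ⁻¹ • t)) (φ : L2) ∈ A.domain := φ.2.1

theorem integrable_of_filterDomain (A : L2 →ₗ.[ℂ] L2) (Δ : ℝ) (φ : filterDomain A Δ) :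
    Integrable (filterIntegrand A Δ φ (phase_mem_of_filterDomain A Δ φ))
      (volume : Measure (ℝ × ℝ)) := φ.2.2

/-- The filtered operator
`∫ f(t₁) f(t₂) exp(i (X t₁ + Y t₂) / Δ) A exp(-i (X t₁ + Y t₂) / Δ) dt`, as a strong (Bochner)
integral on its natural domain. -/
def filtered (A : L2 →ₗ.[ℂ] L2) (Δ : ℝ) : L2 →ₗ.[ℂ] L2 where
  domain := filterDomain A Δ
  toFun :=
    { toFun := fun φ =>
        ∫ t : ℝ × ℝ, filterIntegrand A Δ φ (phase_mem_of_filterDomain A Δ φ) t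
      map_add' := by
        intro φ χ
        rw [← integral_add (integrable_of_filterDomain A Δ φ) (integrable_of_filterDomain A Δ χ)]
        exact integral_congr_ae (Filter.Eventually.of_forall fun t =>
          filterIntegrand_add A Δ φ χ _ _ _ t)
      map_smul' := by
        intro a φ
        rw [RingHom.id_apply, ← integral_smul]
        exact integral_congr_ae (Filter.Eventually.of_forall fun t =>
          filterIntegrand_smul A Δ a φ _ _ t) }

/-- The modified position operator `X̂` with filter parameter `Δ`. -/
def hatX {ι : Type*} (P : L2 →L[ℂ] L2) (ψ : ι → L2) (c : ι → Plane) (Δ : ℝ) : L2 →ₗ.[ℂ] L2 :=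
  filtered (tildeX P ψ c) Δ

/-- The resolvent set `ρ(T)` of an unbounded operator: those `z` for which
`z - T : dom T → L²` is a bijection with bounded inverse `R`. -/
def resolventSet (T : L2 →ₗ.[ℂ] L2) : Set ℂ :=
  {z | ∃ R : L2 →L[ℂ] L2,
    (∀ φ : T.domain, R (z • (φ : L2) - T φ) = φ) ∧
    ∀ χ : L2, ∃ h : R χ ∈ T.domain, z • R χ - T ⟨R χ, h⟩ = χ}

/-- `T` has uniform spectral gaps: its spectrum is the union of a countable family of sets `σ j`
of real numbers, at mutual distances bounded below by some `d > 0`, and with diameters bounded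
by some `D < ∞`. -/
def HasUniformSpectralGaps (T : L2 →ₗ.[ℂ] L2) : Prop :=
  ∃ (J : Type) (_ : Countable J) (σ : J → Set ℝ) (d D : ℝ), 0 < d ∧
    (resolventSet T)ᶜ = Complex.ofReal '' (⋃ j, σ j) ∧
    (∀ j k : J, j ≠ k → ∀ x ∈ σ j, ∀ y ∈ σ k, d ≤ dist x y) ∧
    ∀ j : J, ∀ x ∈ σ j, ∀ y ∈ σ j, dist x y ≤ D

/-- The set of gaps `G = ⋃ m, (m + 1/4, m + 3/4)`. -/
def gapSet : Set ℝ := ⋃ m : ℤ, Set.Ioo ((m : ℝ) + 1 / 4) ((m : ℝ) + 3 / 4)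

end Wannier

end

namespace Wannier

open scoped InnerProductSpace ENNReal NNReal Topology FourierTransform

/-! ### Resolvent sets of unbounded operators -/

/-! Write `Q = 1 - P`, and let `centerOp` be the diagonal part of `X̃`. Up to a bounded operator,
`X̃` is the position operator `X`, and the filter leaves `X` unchanged. Indeed, the rapid decay of
the kernel `K` makes the commutator `L = X P - P X`, with kernel `(x₁ - y₁) K(x, y)`, bounded. The
localization of the basis makes `E = centerOp - X P = ∑ α, |m α ψ α - X ψ α⟩⟨ψ α|` bounded.
Expanding, `X̃ = X + B` on the domain of `X`, with `B = E + P L`.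

Phases commute with `X`, and `∫ f = f̂(0) = 1`. So filtering keeps `X` and replaces `B` by an
average of its conjugates by phases of size `|t| / Δ`. If conjugation by a phase `u` moves `B` by at
most `D |u| ^ ε`, this average is `B + S` with `‖S‖ = O(Δ ^ (-ε))`. Compressing to `P` gives `P X̂ P
= centerOp + P S P`. The operator `centerOp` is diagonal with integer entries and vanishes on the
range of `Q`, so its resolvent is bounded uniformly at distance more than `1/4` from `ℤ`. For large
`Δ` a Neumann series carries all these points into the resolvent set of `P X̂ P`. Its quadratic form
is real, which forces the spectrum onto the real axis, hence into the intervals `[m - 1/4, m +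
1/4]`.

The threshold `5/2` comes from the Hölder bound for `E`. By a Schur test
(`HasDecayKernel.exists_besselBound`), a family dominated by `⟨x - c α⟩ ^ q |ψ α|` is Bessel as soon
as `q + 3/2 < s`. The vectors defining `E` cost one power of the bracket and Hölder continuity costs
`ε` more, so `q = 1 + ε`. The argument is carried by `IsLocalizedBasis.exists_defect`,
`HasDecayKernel.exists_commutator`, `PhaseHolder.exists_filterDefect` and
`IsLocalizedBasis.exists_decomposition`. -/

/-- Neumann series: `z - A' = (1 - S R)(w - A)`, so the inverse is `R (1 - S R)⁻¹`. Allowing `z ≠ w`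
lets the same lemma serve both for perturbing the operator and for moving the spectral parameter. -/
theorem mem_resolventSet_of_perturb {A A' : L2 →ₗ.[ℂ] L2} {w z : ℂ} (R S : L2 →L[ℂ] L2)
    (hdom : A'.domain = A.domain)
    (hleft : ∀ φ : A.domain, R (w • (φ : L2) - A φ) = φ)
    (hright : ∀ χ : L2, ∃ h : R χ ∈ A.domain, w • R χ - A ⟨R χ, h⟩ = χ)
    (hpert : ∀ (φ : L2) (h : φ ∈ A.domain) (h' : φ ∈ A'.domain),
      z • φ - A' ⟨φ, h'⟩ = (w • φ - A ⟨φ, h⟩) - S φ)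
    (hsmall : ‖S‖ * ‖R‖ < 1) : z ∈ resolventSet A' := by
  have hn : ‖S * R‖ < 1 := (norm_mul_le _ _).trans_lt hsmall
  obtain ⟨V, hV⟩ := isUnit_one_sub_of_norm_lt_one hn
  have hVl : ∀ x, (↑V⁻¹ : L2 →L[ℂ] L2) (x - S (R x)) = x := fun x => by
    have := congrArg (fun T : L2 →L[ℂ] L2 => T x) V.inv_mul
    simpa [hV] using this
  have hVr : ∀ x, (↑V⁻¹ : L2 →L[ℂ] L2) x - S (R ((↑V⁻¹ : L2 →L[ℂ] L2) x)) = x := fun x => by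
    have := congrArg (fun T : L2 →L[ℂ] L2 => T x) V.mul_inv
    simpa [hV] using this
  refine ⟨R * ↑V⁻¹, fun φ => ?_, fun χ => ?_⟩
  · have hφ : (φ : L2) ∈ A.domain := hdom ▸ φ.2
    have h1 := hpert φ hφ φ.2
    have h2 := hleft ⟨φ, hφ⟩
    simp only at h2
    have h3 := hVl (w • (φ : L2) - A ⟨φ, hφ⟩)
    rw [h2] at h3
    rw [mul_apply_eq_comp, show A' φ = A' ⟨φ, φ.2⟩ from rfl, h1, h3, h2]
  · obtain ⟨h, e⟩ := hright ((↑V⁻¹ : L2 →L[ℂ] L2) χ)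
    have h' : (R * ↑V⁻¹) χ ∈ A'.domain := hdom ▸ h
    refine ⟨h', ?_⟩
    have h1 := hpert ((R * ↑V⁻¹) χ) h h'
    rw [h1]
    simp only [mul_apply_eq_comp] at e ⊢
    rw [e, hVr]

/-- The quadratic form of `A` takes real values only. -/
def IsSymmetricForm (A : L2 →ₗ.[ℂ] L2) : Prop :=
  ∀ φ : A.domain, (⟪(φ : L2), A φ⟫_ℂ).im = 0

/-- Taking imaginary parts of `⟪R χ, (w - A) R χ⟫` removes `A` and leaves `w.im * ‖R χ‖ ^ 2`. -/
theorem norm_resolvent_le_of_isSymmetricForm {A : L2 →ₗ.[ℂ] L2} (hA : IsSymmetricForm A) {w : ℂ}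
    (hw : w.im ≠ 0) (R : L2 →L[ℂ] L2)
    (hright : ∀ χ : L2, ∃ h : R χ ∈ A.domain, w • R χ - A ⟨R χ, h⟩ = χ) :
    ‖R‖ ≤ |w.im|⁻¹ := by
  refine ContinuousLinearMap.opNorm_le_bound _ (by positivity) fun χ => ?_
  obtain ⟨h, e⟩ := hright χ
  have h1 : (⟪R χ, χ⟫_ℂ).im = w.im * ‖R χ‖ ^ 2 := by
    have h3 : ⟪R χ, χ⟫_ℂ = ⟪R χ, w • R χ - A ⟨R χ, h⟩⟫_ℂ := by rw [e]
    rw [h3, inner_sub_right, inner_smul_right, inner_self_eq_norm_sq_to_K, Complex.sub_im,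
      hA ⟨R χ, h⟩, sub_zero]
    simp [← Complex.ofReal_pow]
  have h2 : |w.im| * ‖R χ‖ ^ 2 ≤ ‖R χ‖ * ‖χ‖ := by
    calc |w.im| * ‖R χ‖ ^ 2 = |(⟪R χ, χ⟫_ℂ).im| := by
          rw [h1, abs_mul, abs_of_nonneg (sq_nonneg ‖R χ‖)]
      _ ≤ ‖⟪R χ, χ⟫_ℂ‖ := Complex.abs_im_le_norm _
      _ ≤ _ := norm_inner_le_norm _ _
  have hw' : 0 < |w.im| := abs_pos.2 hw
  rcases (norm_nonneg (R χ)).eq_or_lt with h0 | h0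
  · rw [← h0]; positivity
  · rw [inv_mul_eq_div, le_div_iff₀ hw']
    nlinarith

/-- If the resolvent set of an operator with real quadratic form contains all points far away from
the real axis, then it contains all non-real points. -/
theorem mem_resolventSet_of_im_ne_zero {A : L2 →ₗ.[ℂ] L2} (hA : IsSymmetricForm A)
    (hfar : ∀ w : ℂ, 1 < |w.im| → w ∈ resolventSet A) {z : ℂ} (hz : z.im ≠ 0) :
    z ∈ resolventSet A := by
  set σ : ℝ := (SignType.sign z.im : ℝ) with hσ
  have hs : |σ| = 1 := by
    rcases lt_or_gt_of_ne hz with h | h <;> simp [hσ, h]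
  have hzs : z.im * σ = |z.im| := self_mul_sign z.im
  have hss : σ * σ = 1 := by rw [← abs_mul_abs_self, hs, one_mul]
  -- One unit step away from the real axis: `|w - z| = 1`, while the resolvent at `w` has norm at
  -- most `1 / (|Im z| + 1) < 1`, so a single Neumann step returns to `z`.
  set w : ℂ := z + (σ : ℂ) * Complex.I with hw
  have hwim : w.im = z.im + σ := by simp [hw]
  have hwabs : |w.im| = |z.im| + 1 := by
    have : w.im * σ = |z.im| + 1 := by rw [hwim, add_mul, hzs, hss]
    calc |w.im| = |w.im| * |σ| := by rw [hs, mul_one]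
      _ = |w.im * σ| := (abs_mul _ _).symm
      _ = _ := by rw [this, abs_of_nonneg (by positivity)]
  have hz' : 0 < |z.im| := abs_pos.2 hz
  obtain ⟨R, hl, hr⟩ := hfar w (by rw [hwabs]; linarith)
  have hwne : w.im ≠ 0 := by rw [← abs_pos, hwabs]; positivity
  have hR := norm_resolvent_le_of_isSymmetricForm hA hwne R hr
  refine mem_resolventSet_of_perturb R ((w - z) • ContinuousLinearMap.id ℂ L2) rfl hl hr
    (fun φ h h' => ?_) ?_
  · simp only [smul_apply, ContinuousLinearMap.id_apply]
    module
  · have h1 : ‖(w - z) • ContinuousLinearMap.id ℂ L2‖ ≤ 1 := by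
      rw [norm_smul]
      have : ‖w - z‖ = 1 := by
        rw [hw, add_sub_cancel_left, norm_mul, Complex.norm_I, mul_one, Complex.norm_real,
          Real.norm_eq_abs, hs]
      rw [this, one_mul]
      exact ContinuousLinearMap.norm_id_le
    calc _ ≤ 1 * |w.im|⁻¹ := by gcongr
      _ < 1 := by rw [one_mul, hwabs]; exact inv_lt_one_of_one_lt₀ (by linarith)

/-- An operator with real quadratic form whose resolvent set contains all points at distance more
than `1/4` from the integers has uniform spectral gaps. -/
theorem hasUniformSpectralGaps_of_far {A : L2 →ₗ.[ℂ] L2} (hA : IsSymmetricForm A)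
    (hfar : ∀ w : ℂ, (∀ m : ℤ, 1 / 4 < ‖w - m‖) → w ∈ resolventSet A) :
    HasUniformSpectralGaps A := by
  have him : ∀ z : ℂ, z ∉ resolventSet A → z.im = 0 := fun z hz => by
    by_contra h
    refine hz (mem_resolventSet_of_im_ne_zero hA (fun w hw => hfar w fun m => ?_) h)
    have := Complex.abs_im_le_norm (w - m)
    simp at this
    linarith
  -- The pieces are the parts of the spectrum in `[m - 1/4, m + 1/4]`, some possibly empty;
  -- neighbouring intervals are `1/2` apart.
  refine ⟨ℤ, inferInstance, fun m => {x | (x : ℂ) ∉ resolventSet A ∧ |x - m| ≤ 1 / 4},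
    1 / 2, 1 / 2, by norm_num, ?_, ?_, ?_⟩
  · ext z
    constructor
    · intro hz
      have hz0 := him z hz
      have hzr : ((z.re : ℝ) : ℂ) = z := by apply Complex.ext <;> simp [hz0]
      have : ∃ m : ℤ, ‖z - m‖ ≤ 1 / 4 := by
        by_contra! h
        exact hz (hfar z h)
      obtain ⟨m, hm⟩ := this
      refine ⟨z.re, Set.mem_iUnion.2 ⟨m, by rw [hzr]; exact hz, ?_⟩, hzr⟩
      rw [← hzr, ← Complex.ofReal_intCast, ← Complex.ofReal_sub, Complex.norm_real] at hm
      exact hm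
    · rintro ⟨x, hx, rfl⟩
      obtain ⟨m, hm, -⟩ := Set.mem_iUnion.1 hx
      exact hm
  · rintro j k hjk x ⟨-, hx⟩ y ⟨-, hy⟩
    have h1 : (1 : ℝ) ≤ |(j : ℝ) - k| := by
      exact_mod_cast Int.one_le_abs (sub_ne_zero.2 hjk)
    rw [Real.dist_eq]
    have h2 : |(j : ℝ) - k| ≤ |x - j| + |x - y| + |y - k| := by
      calc |(j : ℝ) - k| = |-(x - j) + (x - y) + (y - k)| := by ring_nf
        _ ≤ |-(x - j) + (x - y)| + |y - k| := abs_add_le _ _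
        _ ≤ _ := by
          have := abs_add_le (-(x - j)) (x - y)
          rw [abs_neg] at this
          linarith
    linarith
  · rintro j x ⟨-, hx⟩ y ⟨-, hy⟩
    rw [Real.dist_eq]
    have : |x - y| ≤ |x - j| + |y - j| := by
      have := abs_sub (x - j) (y - j)
      simpa using this
    linarith

theorem quarter_lt_norm_sub_of_mem_gapSet {l : ℝ} (hl : l ∈ gapSet) (m : ℤ) :
    1 / 4 < ‖(l : ℂ) - m‖ := by
  obtain ⟨k, hk1, hk2⟩ := Set.mem_iUnion.1 hl
  rw [← Complex.ofReal_intCast, ← Complex.ofReal_sub, Complex.norm_real, Real.norm_eq_abs]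
  rcases le_or_gt m k with h | h
  · have : (m : ℝ) ≤ k := by exact_mod_cast h
    exact (by linarith : (1 / 4 : ℝ) < l - m).trans_le (le_abs_self _)
  · have : (k : ℝ) + 1 ≤ m := by exact_mod_cast h
    exact (by linarith : (1 / 4 : ℝ) < -(l - m)).trans_le (neg_le_abs _)

/-! ### Bessel families -/

/-- The family `g` satisfies the Bessel inequality with constant `C`. -/
def BesselBound {ι : Type*} (g : ι → L2) (C : ℝ) : Prop :=
  0 ≤ C ∧ ∀ (F : Finset ι) (φ : L2), ∑ α ∈ F, ‖⟪g α, φ⟫_ℂ‖ ^ 2 ≤ C ^ 2 * ‖φ‖ ^ 2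

theorem exists_analysisOp {ι : Type*} {g : ι → L2} {C : ℝ} (hg : BesselBound g C) :
    ∃ V : L2 →L[ℂ] lp (fun _ : ι => ℂ) 2, ‖V‖ ≤ C ∧ ∀ φ α, V φ α = ⟪g α, φ⟫_ℂ := by
  have hmem : ∀ φ : L2, Memℓp (fun α => ⟪g α, φ⟫_ℂ) 2 := fun φ => by
    refine memℓp_gen' (C := C ^ 2 * ‖φ‖ ^ 2) fun F => ?_
    simpa using hg.2 F φ
  let V₀ : L2 →ₗ[ℂ] lp (fun _ : ι => ℂ) 2 :=
    { toFun := fun φ => ⟨fun α => ⟪g α, φ⟫_ℂ, hmem φ⟩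
      map_add' := fun φ χ => by ext α; exact inner_add_right _ _ _
      map_smul' := fun a φ => by ext α; exact inner_smul_right _ _ _ }
  refine ⟨V₀.mkContinuous C fun φ => ?_, LinearMap.mkContinuous_norm_le _ hg.1 _, fun φ α => rfl⟩
  refine lp.norm_le_of_forall_sum_le (by norm_num) (mul_nonneg hg.1 (norm_nonneg _)) fun F => ?_
  have := hg.2 F φ
  simpa [V₀, mul_pow] using this

/-- For Bessel families `g` and `h`, the operator `∑ α, |g α⟩⟨h α|`. -/
theorem exists_frameOp {ι : Type*} {g h : ι → L2} {Cg Ch : ℝ} (hg : BesselBound g Cg)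
    (hh : BesselBound h Ch) :
    ∃ E : L2 →L[ℂ] L2, ‖E‖ ≤ Cg * Ch ∧ ∀ φ, HasSum (fun α => ⟪h α, φ⟫_ℂ • g α) (E φ) := by
  classical
  obtain ⟨V, hV, eV⟩ := exists_analysisOp hg
  obtain ⟨W, hW, eW⟩ := exists_analysisOp hh
  -- With analysis operators into `ℓ²`, the sum is `V* W`. Unconditional convergence is inherited
  -- from the expansion of `W φ` in the coordinate vectors of `ℓ²`.
  refine ⟨V.adjoint ∘L W, ?_, fun φ => ?_⟩
  · refine (ContinuousLinearMap.opNorm_comp_le _ _).trans ?_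
    rw [LinearIsometryEquiv.norm_map]
    exact mul_le_mul hV hW (norm_nonneg _) hg.1
  · have h1 := (lp.hasSum_single (p := 2) (by norm_num) (W φ)).mapL V.adjoint
    change HasSum _ (V.adjoint (W φ))
    convert h1 using 2 with α
    refine ext_inner_right ℂ fun χ => ?_
    rw [ContinuousLinearMap.adjoint_inner_left, lp.inner_single_left, eV, eW, inner_smul_left,
      RCLike.inner_apply, mul_comm]

/-! ### The Japanese bracket -/

theorem bracket_eq (x : Plane) : bracket x = (1 + ‖x‖ ^ 2) ^ (1 / 2 : ℝ) := by
  rw [bracket, Real.sqrt_eq_rpow]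

theorem one_le_bracket (x : Plane) : 1 ≤ bracket x := by
  rw [bracket, Real.one_le_sqrt]; nlinarith [sq_nonneg ‖x‖]

theorem bracket_pos (x : Plane) : 0 < bracket x := zero_lt_one.trans_le (one_le_bracket x)

theorem norm_le_bracket (x : Plane) : ‖x‖ ≤ bracket x :=
  Real.le_sqrt_of_sq_le (by linarith)

theorem bracket_le_one_add_norm (x : Plane) : bracket x ≤ 1 + ‖x‖ :=
  Real.sqrt_le_iff.2 ⟨by positivity, by nlinarith [norm_nonneg x]⟩

theorem bracket_neg (x : Plane) : bracket (-x) = bracket x := by simp [bracket]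

theorem bracket_sub_comm (x y : Plane) : bracket (x - y) = bracket (y - x) := by
  rw [← bracket_neg, neg_sub]

@[fun_prop]
theorem continuous_bracket : Continuous bracket := by
  unfold bracket; fun_prop

theorem abs_coord_le_norm (x : Plane) (i : Fin 2) : |x i| ≤ ‖x‖ := by
  simpa using PiLp.norm_apply_le x i

@[fun_prop]
theorem continuous_bracket_rpow (r : ℝ) : Continuous fun x => bracket x ^ r :=
  continuous_bracket.rpow_const fun x => Or.inl (bracket_pos x).ne'

/-- Peetre's inequality; it moves polynomial weights from one base point to another. -/
theorem bracket_add_le (x y : Plane) : bracket (x + y) ≤ 2 * (bracket x * bracket y) := by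
  have h1 := bracket_le_one_add_norm (x + y)
  have h2 := norm_add_le x y
  have h3 := norm_le_bracket x
  have h4 := norm_le_bracket y
  have h5 := one_le_bracket x
  have h6 := one_le_bracket y
  have h7 : bracket (x + y) ^ 2 ≤ (2 * (bracket x * bracket y)) ^ 2 := by
    have e : ∀ z, bracket z ^ 2 = 1 + ‖z‖ ^ 2 := fun z => Real.sq_sqrt (by positivity)
    rw [mul_pow, mul_pow, e, e, e]
    nlinarith [norm_nonneg (x + y), norm_nonneg x, norm_nonneg y, sq_nonneg (‖x‖ - ‖y‖),
      mul_nonneg (sq_nonneg ‖x‖) (sq_nonneg ‖y‖), pow_le_pow_left₀ (norm_nonneg (x + y)) h2 2]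
  exact le_of_sq_le_sq h7 (by positivity)

theorem bracket_rpow_add_le (x y : Plane) {r : ℝ} (hr : 0 ≤ r) :
    bracket (x + y) ^ r ≤ 2 ^ r * (bracket x ^ r * bracket y ^ r) := by
  have hx := bracket_pos x
  have hy := bracket_pos y
  rw [← Real.mul_rpow hx.le hy.le, ← Real.mul_rpow (by norm_num) (by positivity)]
  exact Real.rpow_le_rpow (bracket_pos _).le (bracket_add_le x y) hr

theorem bracket_rpow_le_rpow (x : Plane) {r r' : ℝ} (h : r ≤ r') : bracket x ^ r ≤ bracket x ^ r' :=
  Real.rpow_le_rpow_of_exponent_le (one_le_bracket x) h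

theorem integrable_bracket_rpow {r : ℝ} (hr : r < -2) :
    Integrable (fun x : Plane => bracket x ^ r) volume := by
  have := integrable_rpow_neg_one_add_norm_sq (E := Plane) (μ := volume) (r := -r)
    (by rw [finrank_euclideanSpace_fin]; norm_num; linarith)
  refine this.congr (Filter.Eventually.of_forall fun x => ?_)
  simp only [bracket_eq]
  rw [← Real.rpow_mul (by positivity)]
  congr 1; ring

/-- The (extended) integral of `⟨x⟩ ^ r`. -/
noncomputable def bracketMass (r : ℝ) : ℝ≥0∞ := ∫⁻ x : Plane, ENNReal.ofReal (bracket x ^ r)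

theorem bracketMass_lt_top {r : ℝ} (hr : r < -2) : bracketMass r < ∞ := by
  have := (integrable_bracket_rpow hr).lintegral_lt_top
  exact this

theorem lintegral_bracket_sub (r : ℝ) (c : Plane) :
    ∫⁻ x : Plane, ENNReal.ofReal (bracket (x - c) ^ r) = bracketMass r :=
  lintegral_sub_right_eq_self (fun x => ENNReal.ofReal (bracket x ^ r)) c

theorem lintegral_bracket_sub' (r : ℝ) (c : Plane) :
    ∫⁻ x : Plane, ENNReal.ofReal (bracket (c - x) ^ r) = bracketMass r := by
  simp_rw [bracket_sub_comm c]
  exact lintegral_bracket_sub r c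

/-- One term of the exponential series at `γ⟨x⟩` gives `n! / γ ^ n`; the factor `exp γ` pays for
`⟨x⟩ ≤ 1 + |x|`. -/
theorem exp_le_bracket_rpow {γ : ℝ} (hγ : 0 < γ) (N : ℝ) :
    ∃ C : ℝ, 0 < C ∧ ∀ x : Plane, Real.exp (-γ * ‖x‖) ≤ C * bracket x ^ (-N) := by
  obtain ⟨n, hn⟩ := exists_nat_ge N
  refine ⟨Real.exp γ * (n.factorial / γ ^ n), by positivity, fun x => ?_⟩
  have hb := bracket_pos x
  have h1 : bracket x ^ N ≤ bracket x ^ n := by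
    rw [← Real.rpow_natCast]; exact bracket_rpow_le_rpow x hn
  have h2 : (γ * bracket x) ^ n / n.factorial ≤ Real.exp (γ * bracket x) :=
    Real.pow_div_factorial_le_exp _ (by positivity) n
  have h3 : Real.exp (γ * bracket x) ≤ Real.exp γ * Real.exp (γ * ‖x‖) := by
    rw [← Real.exp_add]
    refine Real.exp_le_exp.2 ?_
    nlinarith [bracket_le_one_add_norm x]
  rw [Real.rpow_neg hb.le, neg_mul, Real.exp_neg, ← div_eq_mul_inv, inv_eq_one_div,
    div_le_div_iff₀ (Real.exp_pos _) (by positivity), one_mul]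
  have h4 : bracket x ^ n = n.factorial / γ ^ n * ((γ * bracket x) ^ n / n.factorial) := by
    rw [mul_pow]; field_simp
  calc bracket x ^ N ≤ n.factorial / γ ^ n * ((γ * bracket x) ^ n / n.factorial) := h4 ▸ h1
    _ ≤ n.factorial / γ ^ n * (Real.exp γ * Real.exp (γ * ‖x‖)) := by
      gcongr; exact h2.trans h3
    _ = _ := by ring

/-! ### Square integrals -/

theorem ENNReal_rpow_half_sq (a : ℝ≥0∞) : (a ^ (1 / 2 : ℝ)) ^ 2 = a := by
  rw [← ENNReal.rpow_natCast, ← ENNReal.rpow_mul]; norm_num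

theorem lintegral_mul_sq_le {α : Type*} [MeasurableSpace α] (μ : Measure α) {f g : α → ℝ≥0∞}
    (hf : AEMeasurable f μ) (hg : AEMeasurable g μ) :
    (∫⁻ x, f x * g x ∂μ) ^ 2 ≤ (∫⁻ x, f x ^ 2 ∂μ) * ∫⁻ x, g x ^ 2 ∂μ := by
  have h := ENNReal.lintegral_mul_le_Lp_mul_Lq μ Real.HolderConjugate.two_two hf hg
  have h2 := pow_le_pow_left₀ (by positivity) h 2
  rw [mul_pow, ENNReal_rpow_half_sq, ENNReal_rpow_half_sq] at h2
  simpa only [ENNReal.rpow_two, Pi.mul_apply] using h2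

/-- Cauchy–Schwarz for a weighted integral. -/
theorem lintegral_weight_mul_sq_le {α : Type*} [MeasurableSpace α] (μ : Measure α)
    {k g : α → ℝ≥0∞} (hk : AEMeasurable k μ) (hg : AEMeasurable g μ) :
    (∫⁻ x, k x * g x ∂μ) ^ 2 ≤ (∫⁻ x, k x ∂μ) * ∫⁻ x, k x * g x ^ 2 ∂μ := by
  have h := lintegral_mul_sq_le μ (f := fun x => k x ^ (1 / 2 : ℝ))
    (g := fun x => k x ^ (1 / 2 : ℝ) * g x) (hk.pow_const _) ((hk.pow_const _).mul hg)
  have e : ∀ a : ℝ≥0∞, a ^ (1 / 2 : ℝ) * a ^ (1 / 2 : ℝ) = a := fun a => by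
    rw [← ENNReal.rpow_add_of_nonneg _ _ (by norm_num) (by norm_num)]; norm_num
  simpa only [mul_pow, ← mul_assoc, sq (_ ^ (1 / 2 : ℝ)), e] using h

theorem enorm_L2_sq (φ : L2) : ‖φ‖ₑ ^ 2 = ∫⁻ x : Plane, ‖φ x‖ₑ ^ 2 := by
  rw [Lp.enorm_def, eLpNorm_eq_lintegral_rpow_enorm_toReal (by norm_num) (by norm_num)]
  simp only [ENNReal.toReal_ofNat, ENNReal.rpow_two, ENNReal_rpow_half_sq]

theorem lintegral_enorm_sq_lt_top (φ : L2) : ∫⁻ x : Plane, ‖φ x‖ₑ ^ 2 < ∞ := by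
  rw [← enorm_L2_sq]; simp

theorem aemeasurable_enorm_L2 (φ : L2) : AEMeasurable (fun x : Plane => ‖φ x‖ₑ) volume :=
  (Lp.aestronglyMeasurable φ).enorm

theorem memLp_two_of_lintegral {f : Plane → ℂ} (hf : AEStronglyMeasurable f volume)
    (h : ∫⁻ x : Plane, ‖f x‖ₑ ^ 2 < ∞) : MemLp f 2 (volume : Measure Plane) := by
  refine ⟨hf, ?_⟩
  rw [eLpNorm_lt_top_iff_lintegral_rpow_enorm_lt_top (by norm_num) (by norm_num)]
  simpa using h

theorem norm_L2_le_of_lintegral {φ : L2} {C : ℝ} (hC : 0 ≤ C)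
    (h : ∫⁻ x : Plane, ‖φ x‖ₑ ^ 2 ≤ ENNReal.ofReal C ^ 2) : ‖φ‖ ≤ C := by
  rw [← enorm_L2_sq] at h
  have h1 : ‖φ‖ₑ ≤ ENNReal.ofReal C := by
    rwa [ENNReal.pow_le_pow_left_iff two_ne_zero] at h
  rwa [← ofReal_norm, ENNReal.ofReal_le_ofReal_iff hC] at h1

/-! ### Integral operators -/

theorem measurable_ofReal_bracket_sub (r : ℝ) (c : Plane) :
    Measurable fun x : Plane => ENNReal.ofReal (bracket (x - c) ^ r) := by
  have : Continuous fun x : Plane => bracket (x - c) ^ r :=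
    (continuous_bracket_rpow r).comp (by fun_prop)
  exact this.measurable.ennreal_ofReal

theorem measurable_ofReal_bracket_sub' (r : ℝ) (c : Plane) :
    Measurable fun x : Plane => ENNReal.ofReal (bracket (c - x) ^ r) := by
  simp_rw [bracket_sub_comm c]
  exact measurable_ofReal_bracket_sub r c

theorem measurable_ofReal_bracket_prod (r : ℝ) :
    Measurable fun p : Plane × Plane => ENNReal.ofReal (bracket (p.1 - p.2) ^ r) := by
  have : Continuous fun p : Plane × Plane => bracket (p.1 - p.2) ^ r :=
    (continuous_bracket_rpow r).comp (by fun_prop)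
  exact this.measurable.ennreal_ofReal

/-- Schur test: Cauchy–Schwarz with the kernel as weight, then Tonelli. The exponent `-3` serves
because powers below `-2` are integrable over the plane. -/
theorem lintegral_bracket_conv_sq_le {g : Plane → ℝ≥0∞} (hg : AEMeasurable g volume) :
    ∫⁻ x : Plane, (∫⁻ y : Plane, ENNReal.ofReal (bracket (x - y) ^ (-3 : ℝ)) * g y) ^ 2 ≤
      bracketMass (-3) ^ 2 * ∫⁻ y : Plane, g y ^ 2 := by
  have hk := measurable_ofReal_bracket_prod (-3)
  have h1 : ∀ x : Plane,
      (∫⁻ y : Plane, ENNReal.ofReal (bracket (x - y) ^ (-3 : ℝ)) * g y) ^ 2 ≤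
        bracketMass (-3) *
          ∫⁻ y : Plane, ENNReal.ofReal (bracket (x - y) ^ (-3 : ℝ)) * g y ^ 2 := fun x => by
    refine (lintegral_weight_mul_sq_le volume ?_ hg).trans_eq ?_
    · exact (measurable_ofReal_bracket_sub' _ _).aemeasurable
    · rw [lintegral_bracket_sub']
  refine (lintegral_mono h1).trans ?_
  rw [lintegral_const_mul' _ _ (bracketMass_lt_top (by norm_num)).ne, lintegral_lintegral_swap]
  · have h2 : ∀ y : Plane,
        ∫⁻ x : Plane, ENNReal.ofReal (bracket (x - y) ^ (-3 : ℝ)) * g y ^ 2 =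
          bracketMass (-3) * g y ^ 2 := fun y => by
      rw [lintegral_mul_const, lintegral_bracket_sub]
      exact measurable_ofReal_bracket_sub _ _
    simp_rw [h2]
    rw [lintegral_const_mul' _ _ (bracketMass_lt_top (by norm_num)).ne, ← mul_assoc, sq]
  · exact hk.aemeasurable.mul ((hg.pow_const 2).comp_snd)

/-- `H` is a measurable kernel of size at most `C ⟨x - y⟩ ^ (-3)`. -/
structure KernelBound (H : Plane → Plane → ℂ) (C : ℝ) : Prop where
  nonneg : 0 ≤ C
  meas : AEStronglyMeasurable (Function.uncurry H)
    ((volume : Measure Plane).prod (volume : Measure Plane))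
  bound : ∀ᵐ x : Plane, ∀ᵐ y : Plane, ‖H x y‖ ≤ C * bracket (x - y) ^ (-3 : ℝ)

theorem KernelBound.lintegral_enorm_le {H : Plane → Plane → ℂ} {C : ℝ} (hH : KernelBound H C)
    (φ : L2) : ∀ᵐ x : Plane, ∫⁻ y : Plane, ‖H x y * φ y‖ₑ ≤
      ENNReal.ofReal C *
        ∫⁻ y : Plane, ENNReal.ofReal (bracket (x - y) ^ (-3 : ℝ)) * ‖φ y‖ₑ := by
  filter_upwards [hH.bound] with x hx
  rw [← lintegral_const_mul' _ _ ENNReal.ofReal_ne_top]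
  refine lintegral_mono_ae ?_
  filter_upwards [hx] with y hy
  rw [enorm_mul, ← mul_assoc, ← ENNReal.ofReal_mul hH.nonneg]
  gcongr
  rw [← ofReal_norm]
  exact ENNReal.ofReal_le_ofReal hy

theorem lintegral_bracket_conv_sq_lt_top (φ : L2) :
    ∫⁻ x : Plane, (∫⁻ y : Plane, ENNReal.ofReal (bracket (x - y) ^ (-3 : ℝ)) * ‖φ y‖ₑ) ^ 2 < ∞ :=
  (lintegral_bracket_conv_sq_le (aemeasurable_enorm_L2 φ)).trans_lt
    (ENNReal.mul_lt_top (ENNReal.pow_lt_top (bracketMass_lt_top (by norm_num)))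
      (lintegral_enorm_sq_lt_top φ))

theorem aemeasurable_bracket_conv (φ : L2) : AEMeasurable (fun x : Plane =>
    ∫⁻ y : Plane, ENNReal.ofReal (bracket (x - y) ^ (-3 : ℝ)) * ‖φ y‖ₑ) volume := by
  have hk := measurable_ofReal_bracket_prod (-3)
  exact (hk.aemeasurable.mul ((aemeasurable_enorm_L2 φ).comp_snd)).lintegral_prod_right'

theorem KernelBound.aestronglyMeasurable_mul {H : Plane → Plane → ℂ} {C : ℝ}
    (hH : KernelBound H C) (φ : L2) :
    AEStronglyMeasurable (fun p : Plane × Plane => H p.1 p.2 * φ p.2)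
      ((volume : Measure Plane).prod (volume : Measure Plane)) :=
  hH.meas.mul (Lp.aestronglyMeasurable φ).comp_snd

theorem KernelBound.integrable {H : Plane → Plane → ℂ} {C : ℝ} (hH : KernelBound H C) (φ : L2) :
    ∀ᵐ x : Plane, Integrable (fun y => H x y * φ y) volume := by
  have hfin := ae_lt_top' ((aemeasurable_bracket_conv φ).pow_const 2)
    (lintegral_bracket_conv_sq_lt_top φ).ne
  filter_upwards [(hH.aestronglyMeasurable_mul φ).prodMk_left, hfin, hH.lintegral_enorm_le φ]
    with x h1 h2 h3
  refine ⟨h1, h3.trans_lt (ENNReal.mul_lt_top ENNReal.ofReal_lt_top ?_)⟩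
  by_contra h
  rw [not_lt, top_le_iff] at h
  rw [h] at h2
  simp at h2

theorem KernelBound.lintegral_integral_sq_le {H : Plane → Plane → ℂ} {C : ℝ}
    (hH : KernelBound H C) (φ : L2) : ∫⁻ x : Plane, ‖∫ y : Plane, H x y * φ y‖ₑ ^ 2 ≤
      (ENNReal.ofReal C * bracketMass (-3)) ^ 2 * ∫⁻ y : Plane, ‖φ y‖ₑ ^ 2 := by
  calc ∫⁻ x : Plane, ‖∫ y : Plane, H x y * φ y‖ₑ ^ 2
      ≤ ∫⁻ x : Plane, ENNReal.ofReal C ^ 2 *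
        (∫⁻ y : Plane, ENNReal.ofReal (bracket (x - y) ^ (-3 : ℝ)) * ‖φ y‖ₑ) ^ 2 := by
        refine lintegral_mono_ae ?_
        filter_upwards [hH.lintegral_enorm_le φ] with x hx
        rw [← mul_pow]
        gcongr
        exact (enorm_integral_le_lintegral_enorm _).trans hx
    _ = ENNReal.ofReal C ^ 2 * ∫⁻ x : Plane,
        (∫⁻ y : Plane, ENNReal.ofReal (bracket (x - y) ^ (-3 : ℝ)) * ‖φ y‖ₑ) ^ 2 :=
        lintegral_const_mul' _ _ (by simp)
    _ ≤ ENNReal.ofReal C ^ 2 * (bracketMass (-3) ^ 2 * ∫⁻ y : Plane, ‖φ y‖ₑ ^ 2) := by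
        gcongr
        exact lintegral_bracket_conv_sq_le (aemeasurable_enorm_L2 φ)
    _ = _ := by ring

theorem KernelBound.memLp {H : Plane → Plane → ℂ} {C : ℝ} (hH : KernelBound H C) (φ : L2) :
    MemLp (fun x => ∫ y : Plane, H x y * φ y) 2 (volume : Measure Plane) :=
  memLp_two_of_lintegral (hH.aestronglyMeasurable_mul φ).integral_prod_right'
    ((hH.lintegral_integral_sq_le φ).trans_lt
      (ENNReal.mul_lt_top (ENNReal.pow_lt_top (ENNReal.mul_lt_top ENNReal.ofReal_lt_top
        (bracketMass_lt_top (by norm_num)))) (lintegral_enorm_sq_lt_top φ)))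

theorem KernelBound.norm_le {H : Plane → Plane → ℂ} {C : ℝ} (hH : KernelBound H C) {φ χ : L2}
    (h : ∀ᵐ x : Plane, χ x = ∫ y : Plane, H x y * φ y) :
    ‖χ‖ ≤ C * (bracketMass (-3)).toReal * ‖φ‖ := by
  have hC := hH.nonneg
  refine norm_L2_le_of_lintegral (by positivity) ?_
  have : ∫⁻ x : Plane, ‖χ x‖ₑ ^ 2 = ∫⁻ x : Plane, ‖∫ y : Plane, H x y * φ y‖ₑ ^ 2 := by
    refine lintegral_congr_ae ?_
    filter_upwards [h] with x hx
    rw [hx]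
  rw [this]
  refine (hH.lintegral_integral_sq_le φ).trans_eq ?_
  rw [← enorm_L2_sq, ENNReal.ofReal_mul (by positivity), ENNReal.ofReal_mul hC,
    ENNReal.ofReal_toReal (bracketMass_lt_top (by norm_num)).ne, ofReal_norm]
  ring

theorem KernelBound.exists_op {H : Plane → Plane → ℂ} {C : ℝ} (hH : KernelBound H C) :
    ∃ T : L2 →L[ℂ] L2, ‖T‖ ≤ C * (bracketMass (-3)).toReal ∧
      ∀ φ : L2, ∀ᵐ x : Plane, T φ x = ∫ y : Plane, H x y * φ y := by
  have hC := hH.nonneg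
  let T₀ : L2 →ₗ[ℂ] L2 :=
    { toFun := fun φ => (hH.memLp φ).toLp _
      map_add' := fun φ χ => by
        apply Lp.ext
        filter_upwards [(hH.memLp (φ + χ)).coeFn_toLp, (hH.memLp φ).coeFn_toLp,
          (hH.memLp χ).coeFn_toLp, Lp.coeFn_add ((hH.memLp φ).toLp _) ((hH.memLp χ).toLp _),
          hH.integrable φ, hH.integrable χ] with x h1 h2 h3 h4 h5 h6
        rw [h4, Pi.add_apply, h1, h2, h3, ← integral_add h5 h6]
        refine integral_congr_ae ?_
        filter_upwards [Lp.coeFn_add φ χ] with y hy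
        rw [hy, Pi.add_apply, mul_add]
      map_smul' := fun a φ => by
        apply Lp.ext
        filter_upwards [(hH.memLp (a • φ)).coeFn_toLp, (hH.memLp φ).coeFn_toLp,
          Lp.coeFn_smul a ((hH.memLp φ).toLp _)] with x h1 h2 h4
        rw [RingHom.id_apply, h4, Pi.smul_apply, h1, h2, ← integral_smul]
        refine integral_congr_ae ?_
        filter_upwards [Lp.coeFn_smul a φ] with y hy
        rw [hy, Pi.smul_apply, smul_eq_mul, smul_eq_mul]
        ring }
  exact ⟨T₀.mkContinuous _ fun φ => hH.norm_le (hH.memLp φ).coeFn_toLp,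
    LinearMap.mkContinuous_norm_le _ (by positivity) _, fun φ => (hH.memLp φ).coeFn_toLp⟩

/-! ### Multiplication operators -/

theorem exists_mulCLM {g : Plane → ℂ} (hg : Continuous g) {C : ℝ} (hC : ∀ x, ‖g x‖ ≤ C) :
    ∃ T : L2 →L[ℂ] L2, ∀ φ : L2, ∀ᵐ x : Plane, T φ x = g x * φ x := by
  have hm : ∀ φ : L2, MemLp (fun x => g x * φ x) 2 (volume : Measure Plane) := fun φ =>
    (Lp.memLp φ).of_le_mul (hg.aestronglyMeasurable.mul (Lp.aestronglyMeasurable φ))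
      (Filter.Eventually.of_forall fun x => by
        rw [norm_mul]; exact mul_le_mul_of_nonneg_right (hC x) (norm_nonneg _))
  let T₀ : L2 →ₗ[ℂ] L2 :=
    { toFun := fun φ => (hm φ).toLp _
      map_add' := fun φ χ => by
        apply Lp.ext
        filter_upwards [(hm (φ + χ)).coeFn_toLp, (hm φ).coeFn_toLp, (hm χ).coeFn_toLp,
          Lp.coeFn_add ((hm φ).toLp _) ((hm χ).toLp _), Lp.coeFn_add φ χ] with x h1 h2 h3 h4 h5
        rw [h4, Pi.add_apply, h1, h2, h3, h5, Pi.add_apply, mul_add]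
      map_smul' := fun a φ => by
        apply Lp.ext
        filter_upwards [(hm (a • φ)).coeFn_toLp, (hm φ).coeFn_toLp,
          Lp.coeFn_smul a ((hm φ).toLp _), Lp.coeFn_smul a φ] with x h1 h2 h4 h5
        rw [RingHom.id_apply, h4, Pi.smul_apply, h1, h2, h5, Pi.smul_apply, smul_eq_mul,
          smul_eq_mul]
        ring }
  refine ⟨T₀.mkContinuous C fun φ => Lp.norm_le_mul_norm_of_ae_le_mul ?_,
    fun φ => (hm φ).coeFn_toLp⟩
  filter_upwards [(hm φ).coeFn_toLp] with x hx
  change ‖(hm φ).toLp _ x‖ ≤ _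
  rw [hx, norm_mul]
  exact mul_le_mul_of_nonneg_right (hC x) (norm_nonneg _)

/-! ### Phases -/

/-- The phase factor `exp(i (u₁ x₁ + u₂ x₂))`. -/
noncomputable def phaseFn (u : ℝ × ℝ) (x : Plane) : ℂ :=
  Complex.exp (Complex.I * (u.1 * x 0 + u.2 * x 1 : ℝ))

theorem phase_ae (u : ℝ × ℝ) (φ : L2) : ∀ᵐ x : Plane, phase u φ x = phaseFn u x * φ x :=
  (memLp_phase_mul u φ).coeFn_toLp

theorem norm_phaseFn (u : ℝ × ℝ) (x : Plane) : ‖phaseFn u x‖ = 1 := by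
  rw [phaseFn, mul_comm, Complex.norm_exp_ofReal_mul_I]

theorem phaseFn_add (u v : ℝ × ℝ) (x : Plane) : phaseFn (u + v) x = phaseFn u x * phaseFn v x := by
  rw [phaseFn, phaseFn, phaseFn, ← Complex.exp_add, ← mul_add]
  congr 2
  simp only [Prod.fst_add, Prod.snd_add]
  push_cast; ring

theorem phaseFn_sub (u : ℝ × ℝ) (x y : Plane) :
    phaseFn u (x - y) = phaseFn u x * phaseFn (-u) y := by
  rw [phaseFn, phaseFn, phaseFn, ← Complex.exp_add, ← mul_add]
  congr 2
  simp only [Prod.fst_neg, Prod.snd_neg, PiLp.sub_apply]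
  push_cast; ring

theorem phaseFn_zero (x : Plane) : phaseFn 0 x = 1 := by simp [phaseFn]

@[fun_prop]
theorem continuous_phaseFn (u : ℝ × ℝ) : Continuous (phaseFn u) := by
  unfold phaseFn; fun_prop

theorem continuous_phaseFn_left (x : Plane) : Continuous fun u => phaseFn u x := by
  unfold phaseFn; fun_prop

theorem phase_phase (u v : ℝ × ℝ) (φ : L2) : phase u (phase v φ) = phase (u + v) φ := by
  apply Lp.ext
  filter_upwards [phase_ae u (phase v φ), phase_ae v φ, phase_ae (u + v) φ] with x h1 h2 h3
  rw [h1, h2, h3, phaseFn_add, mul_assoc]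

theorem phase_zero (φ : L2) : phase 0 φ = φ := by
  apply Lp.ext
  filter_upwards [phase_ae 0 φ] with x h1
  rw [h1, phaseFn_zero, one_mul]

theorem phase_neg_phase (u : ℝ × ℝ) (φ : L2) : phase (-u) (phase u φ) = φ := by
  rw [phase_phase, neg_add_cancel, phase_zero]

theorem phase_phase_neg (u : ℝ × ℝ) (φ : L2) : phase u (phase (-u) φ) = φ := by
  rw [phase_phase, add_neg_cancel, phase_zero]

theorem norm_phase (u : ℝ × ℝ) (φ : L2) : ‖phase u φ‖ = ‖φ‖ := by
  refine le_antisymm (Lp.norm_le_norm_of_ae_le ?_) (Lp.norm_le_norm_of_ae_le ?_) <;>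
  · filter_upwards [phase_ae u φ] with x h1
    rw [h1, norm_mul, norm_phaseFn, one_mul]

theorem inner_phase_phase (u : ℝ × ℝ) (φ χ : L2) : ⟪phase u φ, phase u χ⟫_ℂ = ⟪φ, χ⟫_ℂ := by
  rw [L2.inner_def, L2.inner_def]
  refine integral_congr_ae ?_
  filter_upwards [phase_ae u φ, phase_ae u χ] with x h1 h2
  rw [h1, h2, RCLike.inner_apply, RCLike.inner_apply, map_mul, mul_mul_mul_comm,
    RCLike.mul_conj, norm_phaseFn]
  simp

/-- The unitary `exp(i (X u₁ + Y u₂))` as a bounded operator. -/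
noncomputable def phaseCLM (u : ℝ × ℝ) : L2 →L[ℂ] L2 :=
  (phase u).mkContinuous 1 fun φ => by rw [norm_phase, one_mul]

theorem phaseCLM_apply (u : ℝ × ℝ) (φ : L2) : phaseCLM u φ = phase u φ := rfl

/-- Dominated convergence with majorant `(2|φ|)²`. This strong continuity gives measurability of the
filter integrands. -/
theorem continuous_phase (φ : L2) : Continuous fun u => phase u φ := by
  rw [continuous_iff_continuousAt]
  intro u
  rw [ContinuousAt, tendsto_iff_edist_tendsto_0]
  have key : Filter.Tendsto (fun v => ∫⁻ x : Plane, ‖(phaseFn v x - phaseFn u x) * φ x‖ₑ ^ 2)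
      (𝓝 u) (𝓝 (∫⁻ _ : Plane, 0)) := by
    refine tendsto_lintegral_filter_of_dominated_convergence (fun x => (2 * ‖φ x‖ₑ) ^ 2) ?_ ?_ ?_ ?_
    · exact Filter.Eventually.of_forall fun v =>
        ((((continuous_phaseFn v).sub (continuous_phaseFn u)).measurable.mul
          (Lp.stronglyMeasurable φ).measurable).enorm.pow_const 2)
    · refine Filter.Eventually.of_forall fun v => Filter.Eventually.of_forall fun x => ?_
      rw [enorm_mul]
      gcongr
      refine enorm_sub_le.trans ?_
      rw [← ofReal_norm, ← ofReal_norm, norm_phaseFn, norm_phaseFn]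
      norm_num
    · simp_rw [mul_pow]
      rw [lintegral_const_mul' _ _ (by simp)]
      exact (ENNReal.mul_lt_top (by simp) (lintegral_enorm_sq_lt_top φ)).ne
    · refine Filter.Eventually.of_forall fun x => ?_
      have : Continuous fun v => ‖(phaseFn v x - phaseFn u x) * φ x‖ₑ ^ 2 := by
        have := continuous_phaseFn_left x
        fun_prop
      simpa using this.tendsto u
  rw [lintegral_zero] at key
  have h2 : ∀ v, ∫⁻ x : Plane, ‖(phaseFn v x - phaseFn u x) * φ x‖ₑ ^ 2 =
      edist (phase v φ) (phase u φ) ^ 2 := fun v => by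
    rw [edist_eq_enorm_sub, enorm_L2_sq]
    refine lintegral_congr_ae ?_
    filter_upwards [phase_ae u φ, phase_ae v φ, Lp.coeFn_sub (phase v φ) (phase u φ)] with x h1 h2 h3
    rw [h3, Pi.sub_apply, h1, h2, sub_mul]
  simp_rw [h2] at key
  have h3 := (ENNReal.continuous_rpow_const (y := 1 / 2)).tendsto 0 |>.comp key
  simp only [Function.comp_def, ← ENNReal.rpow_natCast, ← ENNReal.rpow_mul] at h3
  simpa using h3

/-- Size of a shift of momentum. -/
def shiftSize (u : ℝ × ℝ) : ℝ := |u.1| + |u.2|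

theorem shiftSize_nonneg (u : ℝ × ℝ) : 0 ≤ shiftSize u := by unfold shiftSize; positivity

/-- Interpolates between the bounds `|θ|` and `2`. A fractional power costs only `⟨x⟩ ^ ε`, which is
what permits every `s > 5/2`. -/
theorem norm_phaseFn_sub_one_le {ε : ℝ} (hε : 0 ≤ ε) (hε1 : ε ≤ 1) (u : ℝ × ℝ) (x : Plane) :
    ‖phaseFn u x - 1‖ ≤ 2 * shiftSize u ^ ε * bracket x ^ ε := by
  set θ : ℝ := u.1 * x 0 + u.2 * x 1 with hθ
  have hθle : |θ| ≤ shiftSize u * bracket x := by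
    have h0 := (abs_coord_le_norm x 0).trans (norm_le_bracket x)
    have h1 := (abs_coord_le_norm x 1).trans (norm_le_bracket x)
    calc |θ| ≤ |u.1 * x 0| + |u.2 * x 1| := abs_add_le _ _
      _ = |u.1| * |x 0| + |u.2| * |x 1| := by rw [abs_mul, abs_mul]
      _ ≤ |u.1| * bracket x + |u.2| * bracket x := by gcongr
      _ = _ := by rw [shiftSize]; ring
  have h1 : ‖phaseFn u x - 1‖ ≤ |θ| := by
    have := Real.norm_exp_I_mul_ofReal_sub_one_le (x := θ)
    simpa [phaseFn, hθ] using this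
  have h2 : ‖phaseFn u x - 1‖ ≤ 2 := by
    refine (norm_sub_le _ _).trans ?_
    rw [norm_phaseFn]; norm_num
  rw [mul_assoc, ← Real.mul_rpow (shiftSize_nonneg u) (bracket_pos x).le]
  set t := shiftSize u * bracket x
  have ht : 0 ≤ t := mul_nonneg (shiftSize_nonneg u) (bracket_pos x).le
  rcases le_total t 1 with h | h
  · have : t ≤ t ^ ε := by
      rcases ht.eq_or_lt with h0 | h0
      · rw [← h0]; positivity
      · simpa using Real.rpow_le_rpow_of_exponent_ge h0 h hε1
    nlinarith [Real.rpow_nonneg ht ε]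
  · have : 1 ≤ t ^ ε := Real.one_le_rpow h hε
    linarith

/-! ### The position operator -/

theorem mem_posX_domain {φ : L2} :
    φ ∈ posX.domain ↔ MemLp (fun x : Plane => ((x 0 : ℝ) : ℂ) * φ x) 2 volume := Iff.rfl

theorem posX_ae (φ : posX.domain) :
    ∀ᵐ x : Plane, posX φ x = ((x 0 : ℝ) : ℂ) * (φ : L2) x :=
  (memLp_of_mulDomain _ φ).coeFn_toLp

theorem mem_posX_of_ae {φ ξ : L2} (h : ∀ᵐ x : Plane, ξ x = ((x 0 : ℝ) : ℂ) * φ x) :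
    ∃ hφ : φ ∈ posX.domain, posX ⟨φ, hφ⟩ = ξ := by
  have hm : φ ∈ posX.domain := (memLp_congr_ae h).1 (Lp.memLp ξ)
  refine ⟨hm, Lp.ext ?_⟩
  filter_upwards [posX_ae ⟨φ, hm⟩, h] with x h1 h2
  rw [h1, h2]

theorem phase_posX (u : ℝ × ℝ) {φ : L2} (hφ : φ ∈ posX.domain) :
    ∃ h : phase u φ ∈ posX.domain, posX ⟨phase u φ, h⟩ = phase u (posX ⟨φ, hφ⟩) := by
  refine mem_posX_of_ae ?_
  filter_upwards [phase_ae u φ, phase_ae u (posX ⟨φ, hφ⟩), posX_ae ⟨φ, hφ⟩] with x h1 h2 h3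
  rw [h1, h2, h3]; ring

theorem inner_posX (φ χ : posX.domain) : ⟪posX φ, (χ : L2)⟫_ℂ = ⟪(φ : L2), posX χ⟫_ℂ := by
  rw [L2.inner_def, L2.inner_def]
  refine integral_congr_ae ?_
  filter_upwards [posX_ae φ, posX_ae χ] with x h1 h2
  rw [h1, h2, RCLike.inner_apply, RCLike.inner_apply, map_mul, Complex.conj_ofReal]
  ring

/-- The position operator is closed. -/
theorem posX_closed {β : Type*} {l : Filter β} [l.NeBot] {f g : β → L2} {φ ξ : L2}
    (hmem : ∀ b, ∃ h : f b ∈ posX.domain, posX ⟨f b, h⟩ = g b)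
    (hf : Filter.Tendsto f l (𝓝 φ)) (hg : Filter.Tendsto g l (𝓝 ξ)) :
    ∃ h : φ ∈ posX.domain, posX ⟨φ, h⟩ = ξ := by
  have hne : ∀ x : Plane, ((x 0 : ℝ) : ℂ) + Complex.I ≠ 0 := fun x h => by
    have := congrArg Complex.im h
    simp at this
  -- `R = (X + i)⁻¹` is bounded, so the identity `R (X f + i f) = f` passes to the limit and
  -- exhibits the limit vector in the domain.
  obtain ⟨R, hR⟩ := exists_mulCLM (g := fun x : Plane => (((x 0 : ℝ) : ℂ) + Complex.I)⁻¹) (C := 1)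
    (Continuous.inv₀ (by fun_prop) hne) (fun x => by
      rw [norm_inv]
      refine inv_le_one_of_one_le₀ ?_
      have := Complex.abs_im_le_norm (((x 0 : ℝ) : ℂ) + Complex.I)
      simpa using this)
  have h1 : ∀ b, R (g b + Complex.I • f b) = f b := fun b => by
    obtain ⟨h, e⟩ := hmem b
    apply Lp.ext
    filter_upwards [hR (g b + Complex.I • f b), Lp.coeFn_add (g b) (Complex.I • f b),
      Lp.coeFn_smul Complex.I (f b), posX_ae ⟨f b, h⟩] with x h1 h2 h3 h4
    rw [e] at h4
    rw [h1, h2, Pi.add_apply, h3, Pi.smul_apply, smul_eq_mul, h4, ← add_mul,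
      inv_mul_cancel_left₀ (hne x)]
  have h2 : R (ξ + Complex.I • φ) = φ := by
    refine tendsto_nhds_unique ?_ hf
    refine Filter.Tendsto.congr h1 ?_
    exact (R.continuous.tendsto _).comp (hg.add (hf.const_smul Complex.I))
  refine mem_posX_of_ae ?_
  filter_upwards [hR (ξ + Complex.I • φ), Lp.coeFn_add ξ (Complex.I • φ),
      Lp.coeFn_smul Complex.I φ] with x h3 h4 h5
  rw [h2, h4, Pi.add_apply, h5, Pi.smul_apply, smul_eq_mul, ← div_eq_inv_mul,
    eq_div_iff (hne x)] at h3
  linear_combination -h3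

/-! ### Localized bases -/

/-- `K` is an integral kernel of `P`, decaying faster than any power of `⟨x - y⟩`. -/
structure HasDecayKernel (P : L2 →L[ℂ] L2) (K : Plane → Plane → ℂ) : Prop where
  meas : AEStronglyMeasurable (Function.uncurry K)
    ((volume : Measure Plane).prod (volume : Measure Plane))
  rep : ∀ φ : L2, ∀ᵐ x : Plane, P φ x = ∫ y : Plane, K x y * φ y
  decay : ∀ N : ℝ, ∃ C : ℝ, 0 ≤ C ∧
    ∀ᵐ x : Plane, ∀ᵐ y : Plane, ‖K x y‖ ≤ C * bracket (x - y) ^ (-N)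

/-- The analysis below uses only polynomial decay of every order. -/
theorem HasExpLocalizedKernel.exists_hasDecayKernel {P : L2 →L[ℂ] L2}
    (h : HasExpLocalizedKernel P) : ∃ K, HasDecayKernel P K := by
  obtain ⟨γ, hγ, K, hm, hr, C, hC, hb⟩ := h
  refine ⟨K, hm, hr, fun N => ?_⟩
  obtain ⟨C', hC', hb'⟩ := exp_le_bracket_rpow hγ N
  refine ⟨C * C', by positivity, ?_⟩
  filter_upwards [Measure.ae_ae_of_ae_prod hb] with x hx
  filter_upwards [hx] with y hy
  refine hy.trans ?_
  rw [mul_assoc]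
  gcongr
  exact hb' _

theorem ofReal_bracket_rpow_sq (x : Plane) (r : ℝ) :
    ENNReal.ofReal (bracket x ^ r) ^ 2 = ENNReal.ofReal (bracket x ^ (2 * r)) := by
  rw [← ENNReal.ofReal_pow (Real.rpow_nonneg (bracket_pos x).le _), ← Real.rpow_natCast,
    ← Real.rpow_mul (bracket_pos x).le, mul_comm r]
  norm_cast

theorem ofReal_bracket_rpow_mul (x : Plane) (r r' : ℝ) :
    ENNReal.ofReal (bracket x ^ r) * ENNReal.ofReal (bracket x ^ r') =
      ENNReal.ofReal (bracket x ^ (r + r')) := by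
  rw [← ENNReal.ofReal_mul (Real.rpow_nonneg (bracket_pos x).le _), Real.rpow_add (bracket_pos x)]

/-- Moments of a vector in terms of extended norms. -/
theorem lintegral_moment (s : ℝ) (φ : L2) (c : Plane) :
    ∫⁻ x : Plane, (ENNReal.ofReal (bracket (x - c) ^ s) * ‖φ x‖ₑ) ^ 2 =
      ∫⁻ x : Plane, ENNReal.ofReal (bracket (x - c) ^ (2 * s) * ‖φ x‖ ^ 2) := by
  refine lintegral_congr fun x => ?_
  rw [mul_pow, ofReal_bracket_rpow_sq, ENNReal.ofReal_mul (Real.rpow_nonneg (bracket_pos _).le _),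
    ENNReal.ofReal_pow (norm_nonneg _), ofReal_norm]

/-- A vector in the range of `P` decays pointwise as fast as in the mean. -/
theorem HasDecayKernel.pointwise_bound {P : L2 →L[ℂ] L2} {K : Plane → Plane → ℂ}
    (hK : HasDecayKernel P K) {s : ℝ} (hs : 0 ≤ s) (M : ℝ) :
    ∃ C : ℝ, 0 ≤ C ∧ ∀ (φ : L2) (c : Plane), P φ = φ →
      ∫⁻ x : Plane, ENNReal.ofReal (bracket (x - c) ^ (2 * s) * ‖φ x‖ ^ 2) ≤ ENNReal.ofReal M →
      ∀ᵐ x : Plane, ‖φ x‖ ≤ C * bracket (x - c) ^ (-s) := by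
  -- The power `s` pays for moving the weight from `x` to `y`; the remaining `3/2` is square
  -- integrable, so Cauchy–Schwarz applies to `φ = P φ = ∫ K φ`.
  obtain ⟨C, hC, hb⟩ := hK.decay (s + 3 / 2)
  have hmass : bracketMass (-3) < ∞ := bracketMass_lt_top (by norm_num)
  set B : ℝ≥0∞ := ENNReal.ofReal (C * 2 ^ s) ^ 2 * (bracketMass (-3) * ENNReal.ofReal M) with hB
  have hBt : B < ∞ := by
    refine ENNReal.mul_lt_top (by simp) (ENNReal.mul_lt_top hmass (by simp))
  refine ⟨Real.sqrt B.toReal, Real.sqrt_nonneg _, fun φ c hφ hmom => ?_⟩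
  rw [← lintegral_moment] at hmom
  have hrep := hK.rep φ
  rw [hφ] at hrep
  filter_upwards [hb, hrep] with x hx hrx
  have hpos : 0 < bracket (x - c) ^ s := Real.rpow_pos_of_pos (bracket_pos _) _
  have key : (ENNReal.ofReal (bracket (x - c) ^ s) * ‖φ x‖ₑ) ^ 2 ≤ B := by
    have h1 : ENNReal.ofReal (bracket (x - c) ^ s) * ‖φ x‖ₑ ≤ ENNReal.ofReal (C * 2 ^ s) *
        ∫⁻ y : Plane, ENNReal.ofReal (bracket (x - y) ^ (-(3 / 2) : ℝ)) *
          (ENNReal.ofReal (bracket (y - c) ^ s) * ‖φ y‖ₑ) := by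
      rw [hrx]
      calc _ ≤ ENNReal.ofReal (bracket (x - c) ^ s) * ∫⁻ y : Plane, ‖K x y * φ y‖ₑ := by
            gcongr; exact enorm_integral_le_lintegral_enorm _
        _ = ∫⁻ y : Plane, ENNReal.ofReal (bracket (x - c) ^ s) * ‖K x y * φ y‖ₑ :=
            (lintegral_const_mul' _ _ ENNReal.ofReal_ne_top).symm
        _ ≤ ∫⁻ y : Plane, ENNReal.ofReal (C * 2 ^ s) *
              (ENNReal.ofReal (bracket (x - y) ^ (-(3 / 2) : ℝ)) *
              (ENNReal.ofReal (bracket (y - c) ^ s) * ‖φ y‖ₑ)) := by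
            refine lintegral_mono_ae ?_
            filter_upwards [hx] with y hy
            have e : (x - y) + (y - c) = x - c := sub_add_sub_cancel x y c
            have hadd := bracket_rpow_add_le (x - y) (y - c) hs
            rw [e] at hadd
            rw [enorm_mul, ← mul_assoc, ← mul_assoc, ← mul_assoc]
            refine mul_le_mul' ?_ le_rfl
            rw [← ofReal_norm, ← ENNReal.ofReal_mul hpos.le, ← ENNReal.ofReal_mul (by positivity),
              ← ENNReal.ofReal_mul (mul_nonneg (by positivity)
                (Real.rpow_nonneg (bracket_pos _).le _))]
            refine ENNReal.ofReal_le_ofReal ?_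
            have hxy := bracket_pos (x - y)
            have hyc := bracket_pos (y - c)
            calc bracket (x - c) ^ s * ‖K x y‖ ≤ (2 ^ s * (bracket (x - y) ^ s * bracket (y - c) ^ s)) *
                  (C * bracket (x - y) ^ (-(s + 3 / 2))) := by gcongr
              _ = C * 2 ^ s * (bracket (x - y) ^ s * bracket (x - y) ^ (-(s + 3 / 2))) *
                  bracket (y - c) ^ s := by ring
              _ = _ := by
                rw [← Real.rpow_add hxy]
                congr 4; ring
        _ = _ := lintegral_const_mul' _ _ ENNReal.ofReal_ne_top
    refine (pow_le_pow_left₀ (by positivity) h1 2).trans ?_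
    rw [mul_pow, hB]
    gcongr
    refine (lintegral_mul_sq_le volume (measurable_ofReal_bracket_sub' _ _).aemeasurable
      ((measurable_ofReal_bracket_sub _ _).aemeasurable.mul (aemeasurable_enorm_L2 φ))).trans ?_
    simp only [Pi.mul_apply]
    gcongr
    simp_rw [ofReal_bracket_rpow_sq]
    rw [lintegral_bracket_sub']
    norm_num
  have h2 : (bracket (x - c) ^ s * ‖φ x‖) ^ 2 ≤ B.toReal := by
    rw [← ofReal_norm, ← ENNReal.ofReal_mul hpos.le, ← ENNReal.ofReal_pow (by positivity)] at key
    exact (ENNReal.ofReal_le_iff_le_toReal hBt.ne).1 key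
  have h3 := Real.le_sqrt_of_sq_le h2
  rw [Real.rpow_neg (bracket_pos _).le, ← div_eq_mul_inv, le_div_iff₀ hpos]
  linarith

/-- The density of an orthonormal family in the range of `P` is bounded. -/
theorem HasDecayKernel.sum_sq_le {P : L2 →L[ℂ] L2} {K : Plane → Plane → ℂ}
    (hK : HasDecayKernel P K) :
    ∃ C : ℝ, 0 ≤ C ∧ ∀ {ι : Type*} (ψ : ι → L2), Orthonormal ℂ ψ → (∀ α, P (ψ α) = ψ α) →
      ∀ F : Finset ι, ∀ᵐ x : Plane, ∑ α ∈ F, ‖ψ α x‖ ^ 2 ≤ C := by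
  obtain ⟨C, hC, hb⟩ := hK.decay (3 / 2)
  have hmass : bracketMass (-3) < ∞ := bracketMass_lt_top (by norm_num)
  refine ⟨C ^ 2 * (bracketMass (-3)).toReal, by positivity, fun {ι} ψ hψ hP F => ?_⟩
  have hrep : ∀ᵐ x : Plane, ∀ α ∈ F, ψ α x = ∫ y : Plane, K x y * ψ α y := by
    rw [Filter.eventually_all_finset]
    intro α _
    have := hK.rep (ψ α)
    rwa [hP] at this
  filter_upwards [hb, hrep, hK.meas.prodMk_left] with x hx hr hm
  have hsq : ∫⁻ y : Plane, ‖(starRingEnd ℂ) (K x y)‖ₑ ^ 2 ≤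
      ENNReal.ofReal (C ^ 2 * (bracketMass (-3)).toReal) := by
    calc _ ≤ ∫⁻ y : Plane, ENNReal.ofReal C ^ 2 * ENNReal.ofReal (bracket (x - y) ^ (-3 : ℝ)) := by
          refine lintegral_mono_ae ?_
          filter_upwards [hx] with y hy
          have e : (-3 : ℝ) = 2 * (-(3 / 2)) := by norm_num
          rw [e, ← ofReal_bracket_rpow_sq, ← mul_pow, ← ENNReal.ofReal_mul hC, ← ofReal_norm,
            RCLike.norm_conj]
          gcongr
      _ = ENNReal.ofReal C ^ 2 * bracketMass (-3) := by
          rw [lintegral_const_mul' _ _ (by simp), lintegral_bracket_sub']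
      _ = _ := by
          rw [ENNReal.ofReal_mul (by positivity), ENNReal.ofReal_toReal hmass.ne,
            ENNReal.ofReal_pow hC]
  -- Since `conj K(x, ·)` lies in `L²`, the values `ψ α x` are, up to conjugation, its coefficients
  -- in the orthonormal family; Bessel's inequality bounds their squares.
  have hmem : MemLp (fun y => (starRingEnd ℂ) (K x y)) 2 (volume : Measure Plane) :=
    memLp_two_of_lintegral (Complex.continuous_conj.comp_aestronglyMeasurable hm)
      (hsq.trans_lt ENNReal.ofReal_lt_top)
  have hae := hmem.coeFn_toLp
  have hinner : ∀ α ∈ F, ‖ψ α x‖ = ‖⟪ψ α, hmem.toLp _⟫_ℂ‖ := fun α hα => by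
    rw [norm_inner_symm, L2.inner_def, hr α hα]
    congr 1
    refine integral_congr_ae ?_
    filter_upwards [hae] with y hy
    rw [hy, RCLike.inner_apply, Complex.conj_conj, mul_comm]
  calc ∑ α ∈ F, ‖ψ α x‖ ^ 2 = ∑ α ∈ F, ‖⟪ψ α, hmem.toLp _⟫_ℂ‖ ^ 2 :=
        Finset.sum_congr rfl fun α hα => by rw [hinner α hα]
    _ ≤ ‖hmem.toLp _‖ ^ 2 := hψ.sum_inner_products_le _
    _ ≤ _ := by
      have h1 : ‖hmem.toLp _‖ₑ ^ 2 ≤ ENNReal.ofReal (C ^ 2 * (bracketMass (-3)).toReal) := by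
        rw [enorm_L2_sq]
        refine le_trans (le_of_eq (lintegral_congr_ae ?_)) hsq
        filter_upwards [hae] with y hy
        rw [hy]
      rw [← ofReal_norm, ← ENNReal.ofReal_pow (norm_nonneg _)] at h1
      exact (ENNReal.ofReal_le_ofReal_iff (by positivity)).1 h1

/-- A quantitative form of the fact that a vector with bounded moments has mass near its center. -/
theorem exists_le_lintegral_bracket_neg {s : ℝ} (hs : 0 < s) {ρ : ℝ} (hρ : 0 ≤ ρ) {M : ℝ}
    (hM : 0 < M) :
    ∃ κ : ℝ, 0 < κ ∧ ∀ (φ : L2) (c : Plane), ‖φ‖ = 1 →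
      ∫⁻ x : Plane, ENNReal.ofReal (bracket (x - c) ^ (2 * s) * ‖φ x‖ ^ 2) ≤ ENNReal.ofReal M →
      1 ≤ ENNReal.ofReal κ *
        ∫⁻ x : Plane, ENNReal.ofReal (bracket (x - c) ^ (-ρ)) * ‖φ x‖ₑ ^ 2 := by
  -- With `R ^ (2 s) = 2 M`, Chebyshev leaves at most half of the unit mass where `⟨x - c⟩ ≥ R`.
  set R : ℝ := (2 * M) ^ (1 / (2 * s)) with hR
  have hRpos : 0 < R := by positivity
  have hRs : R ^ (2 * s) = 2 * M := by
    rw [hR, ← Real.rpow_mul (by positivity), one_div_mul_cancel (by positivity), Real.rpow_one]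
  refine ⟨2 * R ^ ρ, by positivity, fun φ c hφ hmom => ?_⟩
  have hpt : ∀ x : Plane, (1 : ℝ) ≤ R ^ ρ * bracket (x - c) ^ (-ρ) +
      (2 * M)⁻¹ * bracket (x - c) ^ (2 * s) := fun x => by
    have hb := bracket_pos (x - c)
    rcases le_total (bracket (x - c)) R with h | h
    · have : 1 ≤ R ^ ρ * bracket (x - c) ^ (-ρ) := by
        rw [Real.rpow_neg hb.le, ← div_eq_mul_inv, one_le_div (by positivity)]
        exact Real.rpow_le_rpow hb.le h hρ
      have h2 : 0 ≤ (2 * M)⁻¹ * bracket (x - c) ^ (2 * s) := by positivity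
      linarith
    · have : 1 ≤ (2 * M)⁻¹ * bracket (x - c) ^ (2 * s) := by
        rw [inv_mul_eq_div, one_le_div (by positivity), ← hRs]
        exact Real.rpow_le_rpow hRpos.le h (by positivity)
      have h2 : 0 ≤ R ^ ρ * bracket (x - c) ^ (-ρ) := by positivity
      linarith
  set I := ∫⁻ x : Plane, ENNReal.ofReal (bracket (x - c) ^ (-ρ)) * ‖φ x‖ₑ ^ 2 with hI
  have h1 : (1 : ℝ≥0∞) ≤ ENNReal.ofReal (R ^ ρ) * I + ENNReal.ofReal ((2 * M)⁻¹) * ENNReal.ofReal M := by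
    calc (1 : ℝ≥0∞) = ∫⁻ x : Plane, ‖φ x‖ₑ ^ 2 := by
          rw [← enorm_L2_sq, ← ofReal_norm, hφ]; simp
      _ ≤ ∫⁻ x : Plane, (ENNReal.ofReal (R ^ ρ) *
            (ENNReal.ofReal (bracket (x - c) ^ (-ρ)) * ‖φ x‖ₑ ^ 2) +
            ENNReal.ofReal ((2 * M)⁻¹) *
              ENNReal.ofReal (bracket (x - c) ^ (2 * s) * ‖φ x‖ ^ 2)) := by
          refine lintegral_mono fun x => ?_
          have hb := bracket_pos (x - c)
          simp only
          rw [← ofReal_norm, ← ENNReal.ofReal_pow (norm_nonneg _),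
            ← ENNReal.ofReal_mul (by positivity), ← ENNReal.ofReal_mul (by positivity),
            ← ENNReal.ofReal_mul (by positivity), ← ENNReal.ofReal_add (by positivity)
            (by positivity)]
          refine ENNReal.ofReal_le_ofReal ?_
          have := mul_le_mul_of_nonneg_right (hpt x) (sq_nonneg ‖φ x‖)
          nlinarith
      _ = ENNReal.ofReal (R ^ ρ) * I + ENNReal.ofReal ((2 * M)⁻¹) *
            ∫⁻ x : Plane, ENNReal.ofReal (bracket (x - c) ^ (2 * s) * ‖φ x‖ ^ 2) := by
          rw [lintegral_add_left', lintegral_const_mul' _ _ ENNReal.ofReal_ne_top,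
            lintegral_const_mul' _ _ ENNReal.ofReal_ne_top]
          exact (((measurable_ofReal_bracket_sub _ _).aemeasurable.mul
            ((aemeasurable_enorm_L2 φ).pow_const 2)).const_mul _)
      _ ≤ _ := by gcongr
  have h2 : ENNReal.ofReal ((2 * M)⁻¹) * ENNReal.ofReal M = ENNReal.ofReal (1 / 2) := by
    rw [← ENNReal.ofReal_mul (by positivity)]
    congr 1; field_simp
  rw [h2] at h1
  have h3 : ENNReal.ofReal (1 / 2) ≤ ENNReal.ofReal (R ^ ρ) * I := by
    have h4 : (1 : ℝ≥0∞) = ENNReal.ofReal (1 / 2) + ENNReal.ofReal (1 / 2) := by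
      rw [← ENNReal.ofReal_add (by norm_num) (by norm_num)]; norm_num
    rw [h4] at h1
    exact (ENNReal.add_le_add_iff_right ENNReal.ofReal_ne_top).1 h1
  calc (1 : ℝ≥0∞) = ENNReal.ofReal 2 * ENNReal.ofReal (1 / 2) := by
        rw [← ENNReal.ofReal_mul (by norm_num)]; norm_num
    _ ≤ ENNReal.ofReal 2 * (ENNReal.ofReal (R ^ ρ) * I) := by gcongr
    _ = _ := by rw [← mul_assoc, ← ENNReal.ofReal_mul (by norm_num)]

/-- The centers of a localized basis are sparse. -/
theorem HasDecayKernel.sum_bracket_le {P : L2 →L[ℂ] L2} {K : Plane → Plane → ℂ}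
    (hK : HasDecayKernel P K) {ι : Type*} {ψ : ι → L2} {c : ι → Plane} (hψ : Orthonormal ℂ ψ)
    (hP : ∀ α, P (ψ α) = ψ α) {s : ℝ} (hs : 0 < s) {M : ℝ} (hM : 0 < M)
    (hmom : ∀ α, ∫⁻ x : Plane, ENNReal.ofReal (bracket (x - c α) ^ (2 * s) * ‖ψ α x‖ ^ 2)
      ≤ ENNReal.ofReal M) {ρ : ℝ} (hρ : 2 < ρ) :
    ∃ C : ℝ, 0 ≤ C ∧ ∀ (F : Finset ι) (x : Plane), ∑ α ∈ F, bracket (x - c α) ^ (-ρ) ≤ C := by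
  obtain ⟨κ, hκ, hmass⟩ := exists_le_lintegral_bracket_neg hs (by linarith : 0 ≤ ρ) hM
  obtain ⟨C, hC, hsum⟩ := hK.sum_sq_le
  have hfin : bracketMass (-ρ) < ∞ := bracketMass_lt_top (by linarith)
  -- Peetre's inequality read backwards, which eliminates the center from a product of two weights.
  have hdouble : ∀ x y z : Plane, bracket (x - z) ^ (-ρ) * bracket (y - z) ^ (-ρ) ≤
      2 ^ ρ * bracket (x - y) ^ (-ρ) := fun x y z => by
    have hxz := bracket_pos (x - z)
    have hyz := bracket_pos (y - z)
    have hxy := bracket_pos (x - y)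
    have h := bracket_rpow_add_le (x - z) (z - y) (by linarith : 0 ≤ ρ)
    rw [sub_add_sub_cancel, bracket_sub_comm z y] at h
    rw [Real.rpow_neg hxz.le, Real.rpow_neg hyz.le, Real.rpow_neg hxy.le, ← mul_inv,
      ← div_eq_mul_inv, inv_eq_one_div, div_le_div_iff₀ (by positivity) (by positivity), one_mul]
    exact h
  refine ⟨(κ * (2 ^ ρ * ((bracketMass (-ρ)).toReal * C))), by positivity, fun F x => ?_⟩
  rw [← ENNReal.ofReal_le_ofReal_iff (by positivity),
    ENNReal.ofReal_sum_of_nonneg fun α _ => Real.rpow_nonneg (bracket_pos _).le _]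
  -- Inserting the mass of `ψ α` near its center turns the sum over centers into an integral against
  -- the density `∑ |ψ α|²`, which is bounded.
  have h1 : ∀ α ∈ F, ENNReal.ofReal (bracket (x - c α) ^ (-ρ)) ≤
      ENNReal.ofReal κ * (ENNReal.ofReal (2 ^ ρ) *
        ∫⁻ y : Plane, ENNReal.ofReal (bracket (x - y) ^ (-ρ)) * ‖ψ α y‖ₑ ^ 2) := fun α _ => by
    calc _ ≤ ENNReal.ofReal (bracket (x - c α) ^ (-ρ)) * (ENNReal.ofReal κ *
          ∫⁻ y : Plane, ENNReal.ofReal (bracket (y - c α) ^ (-ρ)) * ‖ψ α y‖ₑ ^ 2) :=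
          le_mul_of_one_le_right' (hmass (ψ α) (c α) (hψ.1 α) (hmom α))
      _ = ENNReal.ofReal κ * ∫⁻ y : Plane, ENNReal.ofReal (bracket (x - c α) ^ (-ρ)) *
          (ENNReal.ofReal (bracket (y - c α) ^ (-ρ)) * ‖ψ α y‖ₑ ^ 2) := by
          rw [lintegral_const_mul' _ _ ENNReal.ofReal_ne_top]; ring
      _ ≤ _ := by
          refine mul_le_mul' le_rfl ?_
          rw [← lintegral_const_mul' _ _ ENNReal.ofReal_ne_top]
          refine lintegral_mono fun y => ?_
          simp only
          rw [← mul_assoc, ← mul_assoc]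
          refine mul_le_mul' ?_ le_rfl
          have h1 := bracket_pos (x - c α)
          rw [← ENNReal.ofReal_mul (by positivity), ← ENNReal.ofReal_mul (by positivity)]
          exact ENNReal.ofReal_le_ofReal (hdouble _ _ _)
  refine (Finset.sum_le_sum h1).trans ?_
  rw [← Finset.mul_sum, ← Finset.mul_sum, ← lintegral_finsetSum']
  · rw [ENNReal.ofReal_mul hκ.le, ENNReal.ofReal_mul (by positivity)]
    gcongr
    calc _ ≤ ∫⁻ y : Plane, ENNReal.ofReal (bracket (x - y) ^ (-ρ)) * ENNReal.ofReal C := by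
          refine lintegral_mono_ae ?_
          filter_upwards [hsum ψ hψ hP F] with y hy
          rw [← Finset.mul_sum]
          gcongr
          refine le_trans (le_of_eq ?_) (ENNReal.ofReal_le_ofReal hy)
          rw [ENNReal.ofReal_sum_of_nonneg fun α _ => sq_nonneg _]
          refine Finset.sum_congr rfl fun α _ => ?_
          rw [ENNReal.ofReal_pow (norm_nonneg _), ofReal_norm]
      _ = bracketMass (-ρ) * ENNReal.ofReal C := by
          rw [lintegral_mul_const _ (measurable_ofReal_bracket_sub' _ _), lintegral_bracket_sub']
      _ = _ := by
          rw [ENNReal.ofReal_mul (by positivity), ENNReal.ofReal_toReal hfin.ne]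
  · exact fun α _ => (measurable_ofReal_bracket_sub' _ _).aemeasurable.mul
      ((aemeasurable_enorm_L2 _).pow_const 2)

/-- Families dominated by weighted elements of a localized basis are Bessel families. -/
theorem HasDecayKernel.exists_besselBound {P : L2 →L[ℂ] L2} {K : Plane → Plane → ℂ}
    (hK : HasDecayKernel P K) {ι : Type*} {ψ : ι → L2} {c : ι → Plane} (hψ : Orthonormal ℂ ψ)
    (hP : ∀ α, P (ψ α) = ψ α) {s : ℝ} (hs : 0 < s) {M : ℝ} (hM : 0 < M)
    (hmom : ∀ α, ∫⁻ x : Plane, ENNReal.ofReal (bracket (x - c α) ^ (2 * s) * ‖ψ α x‖ ^ 2)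
      ≤ ENNReal.ofReal M) {q : ℝ} (hq : q + 3 / 2 < s) :
    ∃ C : ℝ, 0 ≤ C ∧ ∀ (h : ι → L2) (a : ℝ), 0 ≤ a →
      (∀ α, ∀ᵐ x : Plane, ‖h α x‖ ≤ a * bracket (x - c α) ^ q * ‖ψ α x‖) →
      BesselBound h (C * a) := by
  obtain ⟨C₁, hC₁, hpt⟩ := hK.pointwise_bound hs.le M
  -- Second half of the Schur test: pointwise decay `⟨·⟩ ^ (-s)` times the weight `⟨·⟩ ^ (q - 1/2)`
  -- must be summable over the centers, which needs total decay above `2`.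
  obtain ⟨C₂, hC₂, hsum⟩ := hK.sum_bracket_le hψ hP hs hM hmom
    (ρ := s - q + 1 / 2) (by linarith)
  -- First half: by Cauchy–Schwarz against the `s`-moment, the weight `⟨·⟩ ^ (q + 1/2)` has finite
  -- integral against `|ψ α|`. The split `q ± 1/2` makes both halves require the same condition `q +
  -- 3/2 < s`.
  have hmass : bracketMass (2 * (q + 1 / 2 - s)) < ∞ := bracketMass_lt_top (by linarith)
  set A : ℝ := Real.sqrt (M * (bracketMass (2 * (q + 1 / 2 - s))).toReal) with hA
  have hA0 : 0 ≤ A := Real.sqrt_nonneg _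
  have hB0 : 0 ≤ C₁ * C₂ := by positivity
  -- first moments of the basis functions
  have hfirst : ∀ α, ∫⁻ x : Plane, ENNReal.ofReal (bracket (x - c α) ^ (q + 1 / 2)) * ‖ψ α x‖ₑ ≤
      ENNReal.ofReal A := fun α => by
    have h1 := lintegral_mul_sq_le volume
      (measurable_ofReal_bracket_sub (q + 1 / 2 - s) (c α)).aemeasurable
      ((measurable_ofReal_bracket_sub s (c α)).aemeasurable.mul (aemeasurable_enorm_L2 (ψ α)))
    simp only [Pi.mul_apply] at h1
    rw [lintegral_moment] at h1
    simp_rw [ofReal_bracket_rpow_sq, ← mul_assoc, ofReal_bracket_rpow_mul, sub_add_cancel] at h1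
    rw [lintegral_bracket_sub] at h1
    have h2 : ENNReal.ofReal A ^ 2 = bracketMass (2 * (q + 1 / 2 - s)) * ENNReal.ofReal M := by
      rw [← ENNReal.ofReal_pow hA0, hA, Real.sq_sqrt (by positivity), ENNReal.ofReal_mul hM.le,
        ENNReal.ofReal_toReal hmass.ne, mul_comm]
    rw [← ENNReal.pow_le_pow_left_iff two_ne_zero, h2]
    exact h1.trans (by gcongr; exact hmom α)
  have hsecond : ∀ F : Finset ι, ∀ᵐ x : Plane,
      ∑ α ∈ F, ENNReal.ofReal (bracket (x - c α) ^ (q - 1 / 2)) * ‖ψ α x‖ₑ ≤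
        ENNReal.ofReal (C₁ * C₂) := fun F => by
    have : ∀ᵐ x : Plane, ∀ α ∈ F, ‖ψ α x‖ ≤ C₁ * bracket (x - c α) ^ (-s) := by
      rw [Filter.eventually_all_finset]
      exact fun α _ => hpt (ψ α) (c α) (hP α) (hmom α)
    filter_upwards [this] with x hx
    calc _ ≤ ∑ α ∈ F, ENNReal.ofReal (C₁ * bracket (x - c α) ^ (-(s - q + 1 / 2))) := by
          refine Finset.sum_le_sum fun α hα => ?_
          have hb := bracket_pos (x - c α)
          rw [← ofReal_norm, ← ENNReal.ofReal_mul (by positivity)]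
          refine ENNReal.ofReal_le_ofReal ?_
          calc _ ≤ bracket (x - c α) ^ (q - 1 / 2) * (C₁ * bracket (x - c α) ^ (-s)) := by
                gcongr; exact hx α hα
            _ = C₁ * (bracket (x - c α) ^ (q - 1 / 2) * bracket (x - c α) ^ (-s)) := by ring
            _ = _ := by rw [← Real.rpow_add hb]; congr 2; ring
      _ = ENNReal.ofReal (∑ α ∈ F, C₁ * bracket (x - c α) ^ (-(s - q + 1 / 2))) :=
          (ENNReal.ofReal_sum_of_nonneg fun α _ =>
            mul_nonneg hC₁ (Real.rpow_nonneg (bracket_pos _).le _)).symm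
      _ ≤ _ := by
          refine ENNReal.ofReal_le_ofReal ?_
          rw [← Finset.mul_sum]
          gcongr
          exact hsum F x
  refine ⟨Real.sqrt (A * (C₁ * C₂)), Real.sqrt_nonneg _, fun h a ha hh => ⟨by positivity,
    fun F φ => ?_⟩⟩
  have hmeas : ∀ α, AEMeasurable (fun x : Plane => ENNReal.ofReal (bracket (x - c α) ^ (q - 1 / 2)) *
      ‖ψ α x‖ₑ * ‖φ x‖ₑ ^ 2) volume := fun α =>
    (((measurable_ofReal_bracket_sub _ _).aemeasurable.mul (aemeasurable_enorm_L2 _)).mul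
      ((aemeasurable_enorm_L2 φ).pow_const 2))
  -- Split `⟨·⟩ ^ q` as `⟨·⟩ ^ (q + 1/2) * ⟨·⟩ ^ (-1/2)` and apply Cauchy–Schwarz with weight `⟨·⟩ ^
  -- (q + 1/2) |ψ α|`; the squared second factor lowers the exponent to `q - 1/2`.
  have hterm : ∀ α, ‖⟪h α, φ⟫_ℂ‖ₑ ^ 2 ≤ ENNReal.ofReal a ^ 2 * (ENNReal.ofReal A *
      ∫⁻ x : Plane, ENNReal.ofReal (bracket (x - c α) ^ (q - 1 / 2)) * ‖ψ α x‖ₑ * ‖φ x‖ₑ ^ 2) :=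
    fun α => by
    have h1 : ‖⟪h α, φ⟫_ℂ‖ₑ ≤ ENNReal.ofReal a *
        ∫⁻ x : Plane, (ENNReal.ofReal (bracket (x - c α) ^ (q + 1 / 2)) * ‖ψ α x‖ₑ) *
          (ENNReal.ofReal (bracket (x - c α) ^ (-(1 / 2) : ℝ)) * ‖φ x‖ₑ) := by
      rw [L2.inner_def, ← lintegral_const_mul' _ _ ENNReal.ofReal_ne_top]
      refine (enorm_integral_le_lintegral_enorm _).trans (lintegral_mono_ae ?_)
      filter_upwards [hh α] with x hx
      have hb := bracket_pos (x - c α)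
      rw [RCLike.inner_apply, enorm_mul, mul_comm, ← ofReal_norm, RCLike.norm_conj,
        mul_mul_mul_comm, ofReal_bracket_rpow_mul, ← mul_assoc, ← mul_assoc]
      refine mul_le_mul' ?_ le_rfl
      rw [← ofReal_norm, ← ENNReal.ofReal_mul ha, ← ENNReal.ofReal_mul (by positivity)]
      refine ENNReal.ofReal_le_ofReal (hx.trans_eq ?_)
      congr 3; ring
    refine (pow_le_pow_left₀ (by positivity) h1 2).trans ?_
    rw [mul_pow]
    gcongr
    refine (lintegral_weight_mul_sq_le volume
      ((measurable_ofReal_bracket_sub _ _).aemeasurable.mul (aemeasurable_enorm_L2 _))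
      ((measurable_ofReal_bracket_sub _ _).aemeasurable.mul (aemeasurable_enorm_L2 φ))).trans ?_
    simp only [Pi.mul_apply]
    refine mul_le_mul' (hfirst α) (lintegral_mono fun x => le_of_eq ?_)
    simp only
    rw [mul_pow, ofReal_bracket_rpow_sq]
    calc _ = (ENNReal.ofReal (bracket (x - c α) ^ (q + 1 / 2)) *
          ENNReal.ofReal (bracket (x - c α) ^ (2 * -(1 / 2) : ℝ))) * ‖ψ α x‖ₑ * ‖φ x‖ₑ ^ 2 := by ring
      _ = _ := by rw [ofReal_bracket_rpow_mul]; congr 4; ring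
  have htotal : ∑ α ∈ F, ‖⟪h α, φ⟫_ℂ‖ₑ ^ 2 ≤
      ENNReal.ofReal a ^ 2 * (ENNReal.ofReal A * (ENNReal.ofReal (C₁ * C₂) * ‖φ‖ₑ ^ 2)) := by
    refine (Finset.sum_le_sum fun α _ => hterm α).trans ?_
    rw [← Finset.mul_sum, ← Finset.mul_sum, ← lintegral_finsetSum' _ fun α _ => hmeas α]
    gcongr
    rw [enorm_L2_sq, ← lintegral_const_mul' _ _ ENNReal.ofReal_ne_top]
    refine lintegral_mono_ae ?_
    filter_upwards [hsecond F] with x hx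
    rw [← Finset.sum_mul]
    gcongr
  rw [← ENNReal.ofReal_le_ofReal_iff (by positivity),
    ENNReal.ofReal_sum_of_nonneg fun α _ => sq_nonneg _, mul_pow, Real.sq_sqrt (by positivity)]
  simp_rw [ENNReal.ofReal_pow (norm_nonneg _), ofReal_norm]
  refine htotal.trans_eq ?_
  rw [ENNReal.ofReal_mul (by positivity : 0 ≤ A * (C₁ * C₂) * a ^ 2),
    ENNReal.ofReal_mul (by positivity : 0 ≤ A * (C₁ * C₂)),
    ENNReal.ofReal_mul hA0, ENNReal.ofReal_pow ha, ENNReal.ofReal_pow (norm_nonneg _), ofReal_norm]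
  ring

/-! ### The filter function -/

theorem filterHat_eq (ξ : ℝ) : filterHat ξ = max (1 - ξ ^ 2) 0 ^ 3 := by
  unfold filterHat
  split_ifs with h
  · rw [sq_abs, max_eq_left]
    nlinarith [sq_abs ξ, abs_nonneg ξ]
  · push Not at h
    rw [max_eq_right]
    · norm_num
    · nlinarith [sq_abs ξ, abs_nonneg ξ]

theorem continuous_filterHat : Continuous filterHat := by
  rw [show filterHat = fun ξ => max (1 - ξ ^ 2) 0 ^ 3 from funext filterHat_eq]
  fun_prop

theorem filterHat_of_notMem {ξ : ℝ} (h : ξ ∉ Set.Ioc (-1 : ℝ) 1) : filterHat ξ = 0 := by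
  rw [filterHat_eq, max_eq_right]
  · norm_num
  · rw [Set.mem_Ioc, not_and_or] at h
    rcases h with h | h <;> push Not at h <;> nlinarith

theorem filterHat_of_mem {ξ : ℝ} (h : ξ ∈ Set.Ioc (-1 : ℝ) 1) : filterHat ξ = (1 - ξ ^ 2) ^ 3 := by
  rw [filterHat_eq, max_eq_left]
  nlinarith [h.1, h.2]

theorem filterHat_neg (ξ : ℝ) : filterHat (-ξ) = filterHat ξ := by
  simp [filterHat_eq]

theorem hasCompactSupport_filterHat : HasCompactSupport filterHat :=
  HasCompactSupport.intro (isCompact_Icc (a := (-1 : ℝ)) (b := 1)) fun _ hx =>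
    filterHat_of_notMem fun h => hx ⟨h.1.le, h.2⟩

theorem integrable_filterHat : Integrable (fun ξ => (filterHat ξ : ℂ)) :=
  (Continuous.integrable_of_hasCompactSupport continuous_filterHat
    hasCompactSupport_filterHat).ofReal

theorem integral_filterHat_exp (t : ℝ) :
    ∫ ξ : ℝ, (filterHat ξ : ℂ) * Complex.exp (Complex.I * (ξ * t : ℝ)) =
      ∫ ξ in (-1 : ℝ)..1, ((1 - ξ ^ 2) ^ 3 : ℂ) * Complex.exp (Complex.I * (ξ * t : ℝ)) := by
  rw [intervalIntegral.integral_of_le (by norm_num), ← setIntegral_eq_integral_of_forall_compl_eq_zero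
    (s := Set.Ioc (-1 : ℝ) 1) fun ξ hξ => by rw [filterHat_of_notMem hξ]; simp]
  refine setIntegral_congr_fun measurableSet_Ioc fun ξ hξ => ?_
  simp only [filterHat_of_mem hξ]
  push_cast; rfl

/-- Two integrations by parts: with `g = (1 - ξ²)³` the right-hand integrand is `(g - g'')
exp(iξt)`. They are done at once by the antiderivative `(g' - i t g) exp(iξt)`, which vanishes at
`±1` because `g` and `g'` do. -/
theorem one_add_sq_mul_integral_filterHat (t : ℝ) :
    (1 + t ^ 2 : ℂ) * ∫ ξ : ℝ, (filterHat ξ : ℂ) * Complex.exp (Complex.I * (ξ * t : ℝ)) =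
      ∫ ξ in (-1 : ℝ)..1, ((1 - ξ ^ 2) ^ 3 + 6 * (1 - ξ ^ 2) ^ 2 - 24 * ξ ^ 2 * (1 - ξ ^ 2) : ℂ) *
        Complex.exp (Complex.I * (ξ * t : ℝ)) := by
  rw [integral_filterHat_exp, ← intervalIntegral.integral_const_mul, ← sub_eq_zero,
    ← intervalIntegral.integral_sub (Continuous.intervalIntegrable (by fun_prop) _ _)
      (Continuous.intervalIntegrable (by fun_prop) _ _)]
  have hderiv : ∀ ξ ∈ Set.uIcc (-1 : ℝ) 1, HasDerivAt (fun ξ : ℝ =>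
      (-(Complex.I * t) * (1 - (ξ : ℂ) ^ 2) ^ 3 - 6 * ξ * (1 - (ξ : ℂ) ^ 2) ^ 2) *
        Complex.exp (Complex.I * (ξ * t : ℝ)))
      ((1 + (t : ℂ) ^ 2) * ((1 - (ξ : ℂ) ^ 2) ^ 3 * Complex.exp (Complex.I * (ξ * t : ℝ))) -
        ((1 - (ξ : ℂ) ^ 2) ^ 3 + 6 * (1 - (ξ : ℂ) ^ 2) ^ 2 - 24 * (ξ : ℂ) ^ 2 * (1 - (ξ : ℂ) ^ 2)) *
        Complex.exp (Complex.I * (ξ * t : ℝ))) ξ := fun ξ _ => by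
    have h0 : HasDerivAt (fun ξ : ℝ => (ξ : ℂ)) 1 ξ := Complex.ofRealCLM.hasDerivAt
    have h1 : HasDerivAt (fun ξ : ℝ => (1 : ℂ) - (ξ : ℂ) ^ 2) (-(2 * (ξ : ℂ))) ξ := by
      simpa using (h0.pow 2).const_sub 1
    have h2 : HasDerivAt (fun ξ : ℝ => Complex.exp (Complex.I * (ξ * t : ℝ)))
        (Complex.exp (Complex.I * (ξ * t : ℝ)) * (Complex.I * t)) ξ := by
      have : HasDerivAt (fun ξ : ℝ => Complex.I * ((ξ * t : ℝ) : ℂ)) (Complex.I * t) ξ := by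
        simpa using (h0.mul_const (t : ℂ)).const_mul Complex.I
      exact this.cexp
    have h3 := (((h1.pow 3).const_mul (-(Complex.I * t))).sub
      ((h0.const_mul 6).mul (h1.pow 2))).mul h2
    refine h3.congr_deriv ?_
    simp only [Pi.pow_apply, Pi.mul_apply, Pi.sub_apply]
    generalize Complex.exp (Complex.I * (ξ * t : ℝ)) = e
    push_cast
    linear_combination (-(t : ℂ) ^ 2 * (1 - (ξ : ℂ) ^ 2) ^ 3 * e) * Complex.I_sq
  rw [intervalIntegral.integral_eq_sub_of_hasDerivAt hderiv
    (Continuous.intervalIntegrable (by fun_prop) _ _)]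
  norm_num

/-- The integrand above is at most `1 + 6 + 24 = 31` on an interval of length `2`; the prefactor `1
/ (2π)` is estimated by `1`. -/
theorem norm_filterFn_le (t : ℝ) : ‖filterFn t‖ ≤ 62 / (1 + t ^ 2) := by
  have h := one_add_sq_mul_integral_filterHat t
  have hb : ‖∫ ξ in (-1 : ℝ)..1,
      ((1 - ξ ^ 2) ^ 3 + 6 * (1 - ξ ^ 2) ^ 2 - 24 * ξ ^ 2 * (1 - ξ ^ 2) : ℂ) *
        Complex.exp (Complex.I * (ξ * t : ℝ))‖ ≤ 31 * |1 - (-1 : ℝ)| := by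
    refine intervalIntegral.norm_integral_le_of_norm_le_const fun ξ hξ => ?_
    rw [Set.uIoc_of_le (by norm_num)] at hξ
    rw [norm_mul, mul_comm Complex.I, Complex.norm_exp_ofReal_mul_I, mul_one]
    have h1 : (0 : ℝ) ≤ 1 - ξ ^ 2 := by nlinarith [hξ.1, hξ.2]
    have h2 : 1 - ξ ^ 2 ≤ 1 := by nlinarith
    have e : ((1 - ξ ^ 2) ^ 3 + 6 * (1 - ξ ^ 2) ^ 2 - 24 * ξ ^ 2 * (1 - ξ ^ 2) : ℂ) =
      (((1 - ξ ^ 2) ^ 3 + 6 * (1 - ξ ^ 2) ^ 2 - 24 * ξ ^ 2 * (1 - ξ ^ 2) : ℝ) : ℂ) := by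
      push_cast; rfl
    rw [e, Complex.norm_real, Real.norm_eq_abs, abs_le]
    have h3 : (1 - ξ ^ 2) ^ 3 ≤ 1 := pow_le_one₀ h1 h2
    have h4 : (1 - ξ ^ 2) ^ 2 ≤ 1 := pow_le_one₀ h1 h2
    have h5 : 0 ≤ (1 - ξ ^ 2) ^ 3 := by positivity
    have h6 : 0 ≤ (1 - ξ ^ 2) ^ 2 := by positivity
    have h7 : 0 ≤ ξ ^ 2 * (1 - ξ ^ 2) := by positivity
    have h8 : ξ ^ 2 * (1 - ξ ^ 2) ≤ 1 := mul_le_one₀ (by linarith) h1 h2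
    constructor <;> linarith
  rw [← h, norm_mul] at hb
  have h1 : ‖(1 + t ^ 2 : ℂ)‖ = 1 + t ^ 2 := by
    have : (1 + t ^ 2 : ℂ) = ((1 + t ^ 2 : ℝ) : ℂ) := by push_cast; rfl
    rw [this, Complex.norm_real, Real.norm_of_nonneg (by positivity)]
  rw [h1] at hb
  have h2 : ‖(2 * Real.pi : ℂ)⁻¹‖ ≤ 1 := by
    have : (2 * Real.pi : ℂ) = ((2 * Real.pi : ℝ) : ℂ) := by push_cast; rfl
    rw [norm_inv, this, Complex.norm_real, Real.norm_of_nonneg (by positivity)]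
    exact inv_le_one_of_one_le₀ (by linarith [Real.pi_gt_three])
  rw [filterFn, norm_mul, le_div_iff₀ (by positivity)]
  norm_num at hb
  calc _ ≤ 1 * ‖∫ ξ : ℝ, (filterHat ξ : ℂ) * Complex.exp (Complex.I * (ξ * t : ℝ))‖ * (1 + t ^ 2) := by
        gcongr
    _ ≤ 62 := by push_cast; linarith

theorem filterFn_eq_fourierInv (t : ℝ) :
    filterFn t = (2 * Real.pi : ℂ)⁻¹ * 𝓕⁻ (fun ξ => (filterHat ξ : ℂ)) (t / (2 * Real.pi)) := by
  rw [filterFn, Real.fourierInv_eq']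
  congr 1
  refine integral_congr_ae (Filter.Eventually.of_forall fun ξ => ?_)
  simp only [smul_eq_mul]
  rw [mul_comm]
  congr 2
  have : (Real.pi : ℂ) ≠ 0 := by exact_mod_cast Real.pi_ne_zero
  simp
  field_simp

/-- Evenness of `f̂` makes `f` real; this is needed for the filter to preserve symmetry. -/
theorem conj_filterFn (t : ℝ) : (starRingEnd ℂ) (filterFn t) = filterFn t := by
  rw [filterFn, map_mul, ← integral_conj, ← integral_neg_eq_self]
  congr 1
  · simp [Complex.conj_ofNat]
  · refine integral_congr_ae (Filter.Eventually.of_forall fun ξ => ?_)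
    simp only [map_mul, Complex.conj_ofReal, filterHat_neg]
    rw [← Complex.exp_conj]
    simp

theorem continuous_filterFn : Continuous filterFn := by
  have hc := continuous_filterHat
  refine continuous_const.mul (continuous_of_dominated (fun t => ?_) (fun t => ?_)
    integrable_filterHat.norm (Filter.Eventually.of_forall fun ξ => by fun_prop))
  · exact Continuous.aestronglyMeasurable (by fun_prop)
  · refine Filter.Eventually.of_forall fun ξ => ?_
    rw [norm_mul, mul_comm Complex.I, Complex.norm_exp_ofReal_mul_I, mul_one]

/-- Decay of order `2` minus the growth `ε ≤ 1/2` leaves at least `3/2 > 1`. The constant is `124 =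
2 * 62`, from `(1 + |t|)² ≤ 2 (1 + t²)`. -/
theorem integrable_one_add_abs_rpow_mul_filterFn {ε : ℝ} (hε : ε ≤ 1 / 2) :
    Integrable fun t : ℝ => (1 + |t|) ^ ε * ‖filterFn t‖ := by
  have h0 := (integrable_one_add_norm (E := ℝ) (μ := volume) (r := 3 / 2) (by simp; norm_num)).const_mul 124
  refine h0.mono' ?_ (Filter.Eventually.of_forall fun t => ?_)
  · refine (Continuous.mul ?_ continuous_filterFn.norm).aestronglyMeasurable
    exact (by fun_prop : Continuous fun t : ℝ => 1 + |t|).rpow_const fun t => Or.inl (by positivity)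
  · rw [Real.norm_of_nonneg (by positivity), Real.norm_eq_abs]
    have h1 := norm_filterFn_le t
    have ht : 0 < 1 + |t| := by positivity
    have h2 : 62 / (1 + t ^ 2) ≤ 124 * (1 + |t|) ^ (-2 : ℝ) := by
      rw [Real.rpow_neg ht.le, ← div_eq_mul_inv, div_le_div_iff₀ (by positivity) (by positivity)]
      norm_num
      nlinarith [sq_abs t, sq_nonneg (|t| - 1)]
    calc (1 + |t|) ^ ε * ‖filterFn t‖ ≤ (1 + |t|) ^ (1 / 2 : ℝ) * (124 * (1 + |t|) ^ (-2 : ℝ)) := by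
          gcongr
          · linarith [abs_nonneg t]
          · exact h1.trans h2
      _ = 124 * ((1 + |t|) ^ (1 / 2 : ℝ) * (1 + |t|) ^ (-2 : ℝ)) := by ring
      _ = _ := by rw [← Real.rpow_add ht]; norm_num

theorem integrable_filterFn : Integrable filterFn := by
  rw [← integrable_norm_iff continuous_filterFn.aestronglyMeasurable]
  simpa using integrable_one_add_abs_rpow_mul_filterFn (ε := 0) (by norm_num)

/-- Fourier inversion evaluated at frequency `0`, where `f̂(0) = 1`; the factors `2π` convert
between the two normalizations. -/
theorem integral_filterFn : ∫ t, filterFn t = 1 := by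
  set g : ℝ → ℂ := fun ξ => (filterHat ξ : ℂ) with hg
  have hpi : (2 * Real.pi) ≠ 0 := by positivity
  have hpi' : (2 * Real.pi : ℂ) ≠ 0 := by exact_mod_cast hpi
  have h1 : 𝓕⁻ g = fun v => (2 * Real.pi : ℂ) * filterFn (2 * Real.pi * v) := by
    funext v
    rw [filterFn_eq_fourierInv, mul_inv_cancel_left₀ hpi', mul_div_cancel_left₀ _ hpi]
  have h2 : Integrable (𝓕⁻ g) := by
    rw [h1]
    exact (integrable_filterFn.comp_mul_left' hpi).const_mul _
  have h3 : Integrable (𝓕 g) := by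
    have := h2.comp_neg
    refine this.congr (Filter.Eventually.of_forall fun v => ?_)
    simp [Real.fourierInv_eq_fourier_neg]
  have h4 : 𝓕 (𝓕⁻ g) = g :=
    Continuous.fourier_fourierInv_eq (Complex.continuous_ofReal.comp continuous_filterHat)
      integrable_filterHat h3
  have h5 := congrFun h4 0
  rw [Real.fourier_eq'] at h5
  simp only [inner_zero_right, mul_zero, Complex.ofReal_zero, zero_mul, Complex.exp_zero,
    one_smul, h1] at h5
  rw [integral_const_mul, Measure.integral_comp_mul_left] at h5
  have hg0 : g 0 = 1 := by simp [hg, filterHat_eq]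
  rw [hg0, abs_of_pos (by positivity), Complex.real_smul] at h5
  push_cast at h5
  rwa [← mul_assoc, mul_inv_cancel₀ hpi', one_mul] at h5

/-- The weight of the two-dimensional filter. -/
noncomputable def filterWeight (t : ℝ × ℝ) : ℂ := filterFn t.1 * filterFn t.2

theorem integrable_filterWeight : Integrable filterWeight :=
  integrable_filterFn.mul_prod integrable_filterFn

theorem integral_filterWeight : ∫ t, filterWeight t = 1 := by
  unfold filterWeight
  rw [show (volume : Measure (ℝ × ℝ)) = volume.prod volume from rfl,
    integral_prod_mul, integral_filterFn, one_mul]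

theorem continuous_filterWeight : Continuous filterWeight :=
  (continuous_filterFn.comp continuous_fst).mul (continuous_filterFn.comp continuous_snd)

theorem conj_filterWeight (t : ℝ × ℝ) : (starRingEnd ℂ) (filterWeight t) = filterWeight t := by
  rw [filterWeight, map_mul, conj_filterFn, conj_filterFn]

@[fun_prop]
theorem continuous_shiftSize : Continuous shiftSize := by unfold shiftSize; fun_prop

/-- The bound `|t₁| + |t₂| ≤ (1 + |t₁|)(1 + |t₂|)` separates the variables. -/
theorem integrable_shiftSize_rpow_mul_filterWeight {ε : ℝ} (hε : 0 ≤ ε) (hε1 : ε ≤ 1 / 2) :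
    Integrable fun t : ℝ × ℝ => shiftSize t ^ ε * ‖filterWeight t‖ := by
  have h0 := (integrable_one_add_abs_rpow_mul_filterFn hε1).mul_prod
    (integrable_one_add_abs_rpow_mul_filterFn hε1)
  refine h0.mono' ?_ (Filter.Eventually.of_forall fun t => ?_)
  · refine (Continuous.mul ?_ continuous_filterWeight.norm).aestronglyMeasurable
    exact continuous_shiftSize.rpow_const fun t => Or.inr hε
  · have hs := shiftSize_nonneg t
    rw [Real.norm_of_nonneg (by positivity), filterWeight, norm_mul]
    calc _ ≤ ((1 + |t.1|) * (1 + |t.2|)) ^ ε * (‖filterFn t.1‖ * ‖filterFn t.2‖) := by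
          gcongr
          unfold shiftSize
          nlinarith [abs_nonneg t.1, abs_nonneg t.2, mul_nonneg (abs_nonneg t.1) (abs_nonneg t.2)]
      _ = _ := by rw [Real.mul_rpow (by positivity) (by positivity)]; ring

/-! ### Hölder continuity of conjugation by phases -/

/-- The conjugates `exp(i X u) T exp(-i X u)` differ from `T` by at most `C |u| ^ ε`. -/
def PhaseHolder (T : L2 →L[ℂ] L2) (ε C : ℝ) : Prop :=
  0 ≤ C ∧ ∀ (u : ℝ × ℝ) (φ : L2),
    ‖phase u (T (phase (-u) φ)) - T φ‖ ≤ C * shiftSize u ^ ε * ‖φ‖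

theorem PhaseHolder.add {T S : L2 →L[ℂ] L2} {ε C D : ℝ} (hT : PhaseHolder T ε C)
    (hS : PhaseHolder S ε D) : PhaseHolder (T + S) ε (C + D) := by
  refine ⟨add_nonneg hT.1 hS.1, fun u φ => ?_⟩
  rw [add_apply, add_apply, map_add, add_sub_add_comm]
  refine (norm_add_le _ _).trans ((add_le_add (hT.2 u φ) (hS.2 u φ)).trans_eq ?_)
  ring

/-- With `T_u` the conjugate of `T`, `T_u S_u - T S = (T_u - T) S_u + T (S_u - S)`. -/
theorem PhaseHolder.mul {T S : L2 →L[ℂ] L2} {ε C D : ℝ} (hT : PhaseHolder T ε C)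
    (hS : PhaseHolder S ε D) : PhaseHolder (T * S) ε (C * ‖S‖ + ‖T‖ * D) := by
  have hC := hT.1
  have hD := hS.1
  refine ⟨by positivity, fun u φ => ?_⟩
  have hu : 0 ≤ shiftSize u ^ ε := Real.rpow_nonneg (shiftSize_nonneg u) _
  set χ := phase u (S (phase (-u) φ)) with hχ
  have h1 : S (phase (-u) φ) = phase (-u) χ := by rw [hχ, phase_neg_phase]
  have h2 : ‖χ‖ ≤ ‖S‖ * ‖φ‖ := by
    rw [hχ, norm_phase]
    exact (S.le_opNorm _).trans_eq (by rw [norm_phase])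
  have h3 : phase u ((T * S) (phase (-u) φ)) - (T * S) φ =
      (phase u (T (phase (-u) χ)) - T χ) + T (χ - S φ) := by
    rw [mul_apply_eq_comp, mul_apply_eq_comp, h1, map_sub]
    abel
  rw [h3]
  calc _ ≤ ‖phase u (T (phase (-u) χ)) - T χ‖ + ‖T (χ - S φ)‖ := norm_add_le _ _
    _ ≤ C * shiftSize u ^ ε * (‖S‖ * ‖φ‖) + ‖T‖ * (D * shiftSize u ^ ε * ‖φ‖) := by
        refine add_le_add ((hT.2 u χ).trans (by gcongr)) ((T.le_opNorm _).trans ?_)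
        gcongr
        exact hS.2 u φ
    _ = _ := by ring

/-- Operators with a rapidly decaying kernel are Hölder continuous under phases. -/
theorem exists_phaseHolder_of_kernel {T : L2 →L[ℂ] L2} {H : Plane → Plane → ℂ} {C : ℝ} (hC : 0 ≤ C)
    (hm : AEStronglyMeasurable (Function.uncurry H)
      ((volume : Measure Plane).prod (volume : Measure Plane)))
    (hb : ∀ᵐ x : Plane, ∀ᵐ y : Plane, ‖H x y‖ ≤ C * bracket (x - y) ^ (-4 : ℝ))
    (hrep : ∀ φ : L2, ∀ᵐ x : Plane, T φ x = ∫ y : Plane, H x y * φ y)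
    {ε : ℝ} (hε : 0 ≤ ε) (hε1 : ε ≤ 1) : ∃ D, PhaseHolder T ε D := by
  refine ⟨2 * C * (bracketMass (-3)).toReal, by positivity, fun u φ => ?_⟩
  have hu : 0 ≤ shiftSize u ^ ε := Real.rpow_nonneg (shiftSize_nonneg u) _
  have hH : KernelBound H C := ⟨hC, hm, by
    filter_upwards [hb] with x hx
    filter_upwards [hx] with y hy
    exact hy.trans (mul_le_mul_of_nonneg_left (bracket_rpow_le_rpow _ (by norm_num)) hC)⟩
  have hcont : Continuous fun p : Plane × Plane => phaseFn u (p.1 - p.2) - 1 := by fun_prop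
  -- Conjugation multiplies the kernel by a phase in `x - y`. Subtracting the kernel costs `⟨x - y⟩
  -- ^ ε` with `ε ≤ 1`, so decay of order `4` leaves order `3`.
  have hG : KernelBound (fun x y => (phaseFn u (x - y) - 1) * H x y)
      (2 * shiftSize u ^ ε * C) := ⟨by positivity, hcont.aestronglyMeasurable.mul hm, by
    filter_upwards [hb] with x hx
    filter_upwards [hx] with y hy
    have hxy := bracket_pos (x - y)
    rw [norm_mul]
    calc _ ≤ (2 * shiftSize u ^ ε * bracket (x - y) ^ ε) * (C * bracket (x - y) ^ (-4 : ℝ)) := by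
          gcongr
          exact norm_phaseFn_sub_one_le hε hε1 u _
      _ = 2 * shiftSize u ^ ε * C * (bracket (x - y) ^ ε * bracket (x - y) ^ (-4 : ℝ)) := by ring
      _ ≤ _ := by
          rw [← Real.rpow_add hxy]
          gcongr 2 * shiftSize u ^ ε * C * ?_
          exact bracket_rpow_le_rpow _ (by linarith)⟩
  refine (hG.norm_le (φ := φ) ?_).trans_eq (by ring)
  filter_upwards [Lp.coeFn_sub (phase u (T (phase (-u) φ))) (T φ), phase_ae u (T (phase (-u) φ)),
    hrep (phase (-u) φ), hrep φ, hH.integrable φ, hH.integrable (phase (-u) φ)]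
    with x h1 h2 h3 h4 h5 h6
  rw [h1, Pi.sub_apply, h2, h3, h4, ← integral_const_mul, ← integral_sub (h6.const_mul _) h5]
  refine integral_congr_ae ?_
  filter_upwards [phase_ae (-u) φ] with y hy
  rw [hy, phaseFn_sub]
  ring

/-- The commutator of the position operator with `P`. -/
theorem HasDecayKernel.exists_commutator {P : L2 →L[ℂ] L2} {K : Plane → Plane → ℂ}
    (hK : HasDecayKernel P K) {ε : ℝ} (hε : 0 ≤ ε) (hε1 : ε ≤ 1) :
    ∃ L : L2 →L[ℂ] L2, (∃ D, PhaseHolder L ε D) ∧ ∀ φ (hφ : φ ∈ posX.domain),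
      ∃ h : P φ ∈ posX.domain, posX ⟨P φ, h⟩ = P (posX ⟨φ, hφ⟩) + L φ := by
  -- One order of decay is spent on the factor `x₁ - y₁`, leaving the order `4` required for Hölder
  -- continuity.
  obtain ⟨C, hC, hb⟩ := hK.decay 5
  set H : Plane → Plane → ℂ := fun x y => ((x 0 - y 0 : ℝ) : ℂ) * K x y with hH
  have hm : AEStronglyMeasurable (Function.uncurry H)
      ((volume : Measure Plane).prod (volume : Measure Plane)) := by
    have : Continuous fun p : Plane × Plane => ((p.1 0 - p.2 0 : ℝ) : ℂ) := by fun_prop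
    exact this.aestronglyMeasurable.mul hK.meas
  have hHb : ∀ᵐ x : Plane, ∀ᵐ y : Plane, ‖H x y‖ ≤ C * bracket (x - y) ^ (-4 : ℝ) := by
    filter_upwards [hb] with x hx
    filter_upwards [hx] with y hy
    have hxy := bracket_pos (x - y)
    rw [hH]
    simp only
    rw [norm_mul, Complex.norm_real, Real.norm_eq_abs]
    calc _ ≤ bracket (x - y) * (C * bracket (x - y) ^ (-5 : ℝ)) := by
          gcongr
          exact (abs_coord_le_norm (x - y) 0).trans (norm_le_bracket _)
      _ = C * (bracket (x - y) ^ (1 : ℝ) * bracket (x - y) ^ (-5 : ℝ)) := by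
          rw [Real.rpow_one]; ring
      _ = _ := by rw [← Real.rpow_add hxy]; norm_num
  have hHk : KernelBound H C := ⟨hC, hm, by
    filter_upwards [hHb] with x hx
    filter_upwards [hx] with y hy
    exact hy.trans (mul_le_mul_of_nonneg_left (bracket_rpow_le_rpow _ (by norm_num)) hC)⟩
  have hKk : KernelBound K C := ⟨hC, hK.meas, by
    filter_upwards [hb] with x hx
    filter_upwards [hx] with y hy
    exact hy.trans (mul_le_mul_of_nonneg_left (bracket_rpow_le_rpow _ (by norm_num)) hC)⟩
  obtain ⟨L, -, hL⟩ := hHk.exists_op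
  refine ⟨L, exists_phaseHolder_of_kernel hC hm hHb hL hε hε1, fun φ hφ => mem_posX_of_ae ?_⟩
  filter_upwards [Lp.coeFn_add (P (posX ⟨φ, hφ⟩)) (L φ), hL φ, hK.rep φ, hK.rep (posX ⟨φ, hφ⟩),
    hHk.integrable φ, hKk.integrable (posX ⟨φ, hφ⟩)] with x h1 h2 h3 h4 h5 h6
  rw [h1, Pi.add_apply, h2, h3, h4, ← integral_add h6 h5, ← integral_const_mul]
  refine integral_congr_ae ?_
  filter_upwards [posX_ae ⟨φ, hφ⟩] with y hy
  rw [hy, hH]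
  push_cast
  ring

theorem HasDecayKernel.exists_phaseHolder {P : L2 →L[ℂ] L2} {K : Plane → Plane → ℂ}
    (hK : HasDecayKernel P K) {ε : ℝ} (hε : 0 ≤ ε) (hε1 : ε ≤ 1) : ∃ D, PhaseHolder P ε D := by
  obtain ⟨C, hC, hb⟩ := hK.decay 4
  exact exists_phaseHolder_of_kernel hC hK.meas hb hK.rep hε hε1

/-- The elements of a localized basis belong to the domain of the position operator. -/
theorem mem_posX_domain_of_moment {φ : L2} {c : Plane} {s : ℝ} (hs : 1 ≤ s) {M : ℝ}
    (h : ∫⁻ x : Plane, ENNReal.ofReal (bracket (x - c) ^ (2 * s) * ‖φ x‖ ^ 2) ≤ ENNReal.ofReal M) :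
    φ ∈ posX.domain := by
  rw [mem_posX_domain]
  have hcont : Continuous fun x : Plane => ((x 0 - c 0 : ℝ) : ℂ) := by fun_prop
  have h1 : MemLp (fun x : Plane => ((x 0 - c 0 : ℝ) : ℂ) * φ x) 2 volume := by
    refine memLp_two_of_lintegral (hcont.aestronglyMeasurable.mul (Lp.aestronglyMeasurable φ))
      (lt_of_le_of_lt ?_ (h.trans_lt ENNReal.ofReal_lt_top))
    rw [← lintegral_moment]
    refine lintegral_mono fun x => ?_
    rw [enorm_mul]
    gcongr
    rw [← ofReal_norm, Complex.norm_real]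
    refine ENNReal.ofReal_le_ofReal ?_
    calc ‖x 0 - c 0‖ ≤ bracket (x - c) := (abs_coord_le_norm (x - c) 0).trans (norm_le_bracket _)
      _ = bracket (x - c) ^ (1 : ℝ) := (Real.rpow_one _).symm
      _ ≤ _ := bracket_rpow_le_rpow _ hs
  refine (memLp_congr_ae (Filter.Eventually.of_forall fun x => ?_)).1
    (h1.add ((Lp.memLp φ).const_mul ((c 0 : ℝ) : ℂ)))
  simp only [Pi.add_apply]
  push_cast
  ring

theorem abs_latticeX_sub_le (c x : Plane) : |(latticeX c : ℝ) - x 0| ≤ 2 * bracket (x - c) := by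
  have h1 := Int.floor_le (c 0 + 1 / 2)
  have h2 := Int.lt_floor_add_one (c 0 + 1 / 2)
  have h3 : |x 0 - c 0| ≤ bracket (x - c) :=
    (abs_coord_le_norm (x - c) 0).trans (norm_le_bracket _)
  have h4 := one_le_bracket (x - c)
  rw [abs_le] at h3 ⊢
  unfold latticeX
  constructor <;> linarith [h3.1, h3.2]

/-! ### Projections and their bases -/

theorem isStarProjection_apply_apply {P : L2 →L[ℂ] L2} (hP : IsStarProjection P) (φ : L2) :
    P (P φ) = P φ := by
  have := congrArg (fun T : L2 →L[ℂ] L2 => T φ) hP.isIdempotentElem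
  simpa using this

theorem isStarProjection_inner {P : L2 →L[ℂ] L2} (hP : IsStarProjection P) (φ χ : L2) :
    ⟪P φ, χ⟫_ℂ = ⟪φ, P χ⟫_ℂ := by
  have h : P.adjoint = P := hP.isSelfAdjoint
  conv_rhs => rw [← h]
  rw [ContinuousLinearMap.adjoint_inner_right]

theorem IsLocalizedBasis.apply_eq {ι : Type*} {P : L2 →L[ℂ] L2} (hP : IsStarProjection P)
    {s : ℝ} {ψ : ι → L2} {c : ι → Plane} (hψ : IsLocalizedBasis P s ψ c) (α : ι) :
    P (ψ α) = ψ α := by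
  have h : ψ α ∈ Set.range P := by
    rw [← hψ.span_eq]
    exact Submodule.le_topologicalClosure _ (Submodule.subset_span ⟨α, rfl⟩)
  obtain ⟨φ, hφ⟩ := h
  rw [← hφ, isStarProjection_apply_apply hP]

theorem besselBound_of_orthonormal {ι : Type*} {ψ : ι → L2} (hψ : Orthonormal ℂ ψ) :
    BesselBound ψ 1 :=
  ⟨zero_le_one, fun F φ => by
    rw [one_pow, one_mul]
    exact hψ.sum_inner_products_le φ⟩

theorem inner_of_hasSum_orthonormal {ι : Type*} {ψ : ι → L2} (hψ : Orthonormal ℂ ψ) {a : ι → ℂ}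
    {φ : L2} (h : HasSum (fun α => a α • ψ α) φ) (β : ι) : ⟪ψ β, φ⟫_ℂ = a β := by
  classical
  have h1 := h.mapL (innerSL ℂ (ψ β))
  refine h1.unique ?_
  convert! hasSum_ite_eq β (a β) using 1
  funext α
  rw [innerSL_apply_apply, inner_smul_right, orthonormal_iff_ite.1 hψ β α]
  by_cases h : α = β
  · subst h; simp
  · simp [h, Ne.symm h]

theorem IsLocalizedBasis.hasSum {ι : Type*} {P : L2 →L[ℂ] L2} (hP : IsStarProjection P)
    {s : ℝ} {ψ : ι → L2} {c : ι → Plane} (hψ : IsLocalizedBasis P s ψ c) (φ : L2) :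
    HasSum (fun α => ⟪ψ α, φ⟫_ℂ • ψ α) (P φ) := by
  have hb := besselBound_of_orthonormal hψ.orthonormal
  obtain ⟨E, -, hE⟩ := exists_frameOp hb hb
  have hE' := hE φ
  set U := (Submodule.span ℂ (Set.range ψ)).topologicalClosure with hU
  have h1 : E φ ∈ U := by
    refine Submodule.isClosed_topologicalClosure _ |>.mem_of_tendsto hE' ?_
    refine Filter.Eventually.of_forall fun F => Submodule.sum_mem _ fun α _ => ?_
    exact Submodule.smul_mem _ _
      (Submodule.le_topologicalClosure _ (Submodule.subset_span ⟨α, rfl⟩))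
  have h2 : P φ ∈ U := by
    have : P φ ∈ (U : Set L2) := hψ.span_eq ▸ ⟨φ, rfl⟩
    exact this
  -- `P φ - E φ` lies both in the closed span `U` and in its orthogonal complement.
  have h3 : P φ - E φ ∈ Uᗮ := by
    rw [hU, Submodule.orthogonal_closure, Submodule.mem_orthogonal]
    intro u hu
    induction hu using Submodule.span_induction with
    | mem x hx =>
      obtain ⟨β, rfl⟩ := hx
      rw [inner_sub_right, inner_of_hasSum_orthonormal hψ.orthonormal hE',
        ← isStarProjection_inner hP, hψ.apply_eq hP, sub_self]
    | zero => exact inner_zero_left _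
    | add x y _ _ hx hy => rw [inner_add_left, hx, hy, add_zero]
    | smul a x _ hx => rw [inner_smul_left, hx, mul_zero]
  have h4 : P φ - E φ = 0 := by
    have := Submodule.inner_right_of_mem_orthogonal (Submodule.sub_mem _ h2 h1) h3
    rwa [inner_self_eq_zero] at this
  rw [sub_eq_zero.1 h4]
  exact hE'

/-! ### The diagonal operator -/

/-- `X φ = ξ`, as a relation. -/
def PosXRel (φ ξ : L2) : Prop := ∃ h : φ ∈ posX.domain, posX ⟨φ, h⟩ = ξ

theorem PosXRel.add {φ ξ φ' ξ' : L2} (h : PosXRel φ ξ) (h' : PosXRel φ' ξ') :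
    PosXRel (φ + φ') (ξ + ξ') := by
  obtain ⟨h, rfl⟩ := h
  obtain ⟨h', rfl⟩ := h'
  exact ⟨posX.domain.add_mem h h', posX.map_add ⟨φ, h⟩ ⟨φ', h'⟩⟩

theorem PosXRel.smul {φ ξ : L2} (h : PosXRel φ ξ) (a : ℂ) : PosXRel (a • φ) (a • ξ) := by
  obtain ⟨h, rfl⟩ := h
  exact ⟨posX.domain.smul_mem a h, posX.map_smul a ⟨φ, h⟩⟩

theorem PosXRel.sub {φ ξ φ' ξ' : L2} (h : PosXRel φ ξ) (h' : PosXRel φ' ξ') :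
    PosXRel (φ - φ') (ξ - ξ') := by
  simpa [sub_eq_add_neg] using h.add (h'.smul (-1))

theorem PosXRel.unique {φ ξ ξ' : L2} (h : PosXRel φ ξ) (h' : PosXRel φ ξ') : ξ = ξ' := by
  obtain ⟨_, rfl⟩ := h
  obtain ⟨_, rfl⟩ := h'
  rfl

theorem PosXRel.sum {ι : Type*} {f g : ι → L2} (h : ∀ α, PosXRel (f α) (g α)) (F : Finset ι) :
    PosXRel (∑ α ∈ F, f α) (∑ α ∈ F, g α) := by
  classical
  induction F using Finset.induction with
  | empty => exact ⟨posX.domain.zero_mem, posX.map_zero⟩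
  | insert a F ha ih =>
    rw [Finset.sum_insert ha, Finset.sum_insert ha]
    exact (h a).add ih

/-- The operator `∑ α, m α |ψ α⟩⟨ψ α|` of lattice coordinates. -/
noncomputable abbrev centerOp {ι : Type*} (ψ : ι → L2) (c : ι → Plane) : L2 →ₗ.[ℂ] L2 :=
  diagOp ψ fun α => ((latticeX (c α) : ℤ) : ℂ)

theorem hasSum_centerOp {ι : Type*} {ψ : ι → L2} {c : ι → Plane} {φ : L2}
    (h : φ ∈ (centerOp ψ c).domain) :
    HasSum (fun α => (((latticeX (c α) : ℤ) : ℂ) * ⟪ψ α, φ⟫_ℂ) • ψ α) (centerOp ψ c ⟨φ, h⟩) :=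
  Summable.hasSum h

theorem centerOp_of_hasSum {ι : Type*} {ψ : ι → L2} {c : ι → Plane} {φ ξ : L2}
    (h : HasSum (fun α => (((latticeX (c α) : ℤ) : ℂ) * ⟪ψ α, φ⟫_ℂ) • ψ α) ξ) :
    ∃ h' : φ ∈ (centerOp ψ c).domain, centerOp ψ c ⟨φ, h'⟩ = ξ :=
  ⟨h.summable, h.tsum_eq⟩

/-- The diagonal operator and `X P` have the same domain and differ by a bounded operator which is
Hölder continuous under phases. -/
theorem IsLocalizedBasis.exists_defect {ι : Type*} {P : L2 →L[ℂ] L2} (hP : IsStarProjection P)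
    {K : Plane → Plane → ℂ} (hK : HasDecayKernel P K) {s : ℝ} {ψ : ι → L2} {c : ι → Plane}
    (hψ : IsLocalizedBasis P s ψ c) {ε : ℝ} (hε : 0 ≤ ε) (hε1 : ε ≤ 1) (hs : 5 / 2 + ε < s) :
    ∃ E : L2 →L[ℂ] L2, (∃ D, PhaseHolder E ε D) ∧ (∀ φ, E (P φ) = E φ) ∧
      (∀ φ, P φ ∈ posX.domain → φ ∈ (centerOp ψ c).domain) ∧
      ∀ φ (h : φ ∈ (centerOp ψ c).domain), PosXRel (P φ) (centerOp ψ c ⟨φ, h⟩ - E φ) := by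
  obtain ⟨M, hM, hmom⟩ := hψ.localized
  have hfix := hψ.apply_eq hP
  have hon := hψ.orthonormal
  obtain ⟨C, hC, hbes⟩ := hK.exists_besselBound hon hfix (by linarith : 0 < s) hM hmom
    (q := 1 + ε) (by linarith)
  have hdom : ∀ α, ψ α ∈ posX.domain := fun α => mem_posX_domain_of_moment (by linarith) (hmom α)
  set m : ι → ℂ := fun α => ((latticeX (c α) : ℤ) : ℂ) with hm
  set g : ι → L2 := fun α => m α • ψ α - posX ⟨ψ α, hdom α⟩ with hg
  have hXψ : ∀ α, PosXRel (ψ α) (m α • ψ α - g α) := fun α => ⟨hdom α, (sub_sub_cancel _ _).symm⟩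
  have hgx : ∀ α, ∀ᵐ x : Plane, ‖g α x‖ ≤ 2 * bracket (x - c α) * ‖ψ α x‖ := fun α => by
    filter_upwards [posX_ae ⟨ψ α, hdom α⟩, Lp.coeFn_sub (m α • ψ α) (posX ⟨ψ α, hdom α⟩),
      Lp.coeFn_smul (m α) (ψ α)] with x h1 h2 h3
    rw [hg]
    simp only
    rw [h2, Pi.sub_apply, h3, Pi.smul_apply, smul_eq_mul, h1, ← sub_mul, norm_mul]
    gcongr
    have : m α - ((x 0 : ℝ) : ℂ) = (((latticeX (c α) : ℝ) - x 0 : ℝ) : ℂ) := by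
      rw [hm]; push_cast; rfl
    rw [this, Complex.norm_real]
    exact abs_latticeX_sub_le _ _
  -- shifted families
  set ph : (ℝ × ℝ) → (ι → L2) → ι → L2 := fun u f α => phaseFn (-u) (c α) • phase u (f α) with hph
  have hphx : ∀ u f α, ∀ᵐ x : Plane, ph u f α x = phaseFn u (x - c α) * f α x := fun u f α => by
    filter_upwards [phase_ae u (f α), Lp.coeFn_smul (phaseFn (-u) (c α)) (phase u (f α))]
      with x h1 h2
    rw [hph]
    simp only
    rw [h2, Pi.smul_apply, h1, smul_eq_mul, phaseFn_sub]
    ring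
  have hdiffx : ∀ u f α, ∀ᵐ x : Plane, ‖(ph u f - f) α x‖ ≤
      2 * shiftSize u ^ ε * bracket (x - c α) ^ ε * ‖f α x‖ := fun u f α => by
    filter_upwards [hphx u f α, Lp.coeFn_sub (ph u f α) (f α)] with x h1 h2
    rw [Pi.sub_apply, h2, Pi.sub_apply, h1, ← sub_one_mul, norm_mul]
    gcongr
    exact norm_phaseFn_sub_one_le hε hε1 u _
  have hone : ∀ x : Plane, 1 ≤ bracket x ^ (1 + ε) := fun x =>
    Real.one_le_rpow (one_le_bracket x) (by linarith)
  have hlin : ∀ x : Plane, bracket x ≤ bracket x ^ (1 + ε) := fun x => by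
    simpa using bracket_rpow_le_rpow x (by linarith : 1 ≤ 1 + ε)
  have Bψ : BesselBound ψ (C * 1) := hbes ψ 1 zero_le_one fun α =>
    Filter.Eventually.of_forall fun x => by
      rw [one_mul]
      exact le_mul_of_one_le_left (norm_nonneg _) (hone _)
  have Bg : BesselBound g (C * 2) := hbes g 2 zero_le_two fun α => by
    filter_upwards [hgx α] with x hx
    refine hx.trans ?_
    gcongr
    exact hlin _
  have Bpg : ∀ u, BesselBound (ph u g) (C * 2) := fun u => hbes _ 2 zero_le_two fun α => by
    filter_upwards [hgx α, hphx u g α] with x hx h2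
    rw [h2, norm_mul, norm_phaseFn, one_mul]
    refine hx.trans ?_
    gcongr
    exact hlin _
  have Bdψ : ∀ u, BesselBound (ph u ψ - ψ) (C * (2 * shiftSize u ^ ε)) := fun u =>
    hbes _ _ (mul_nonneg zero_le_two (Real.rpow_nonneg (shiftSize_nonneg u) _)) fun α => by
      have hu : 0 ≤ shiftSize u ^ ε := Real.rpow_nonneg (shiftSize_nonneg u) _
      filter_upwards [hdiffx u ψ α] with x hx
      refine hx.trans ?_
      gcongr 2 * shiftSize u ^ ε * ?_ * _
      exact bracket_rpow_le_rpow _ (by linarith)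
  -- The critical family: the defect `g` costs one power of the bracket and the phase difference
  -- costs `ε`, exhausting `q = 1 + ε`.
  have Bdg : ∀ u, BesselBound (ph u g - g) (C * (4 * shiftSize u ^ ε)) := fun u =>
    hbes _ _ (mul_nonneg (by norm_num) (Real.rpow_nonneg (shiftSize_nonneg u) _)) fun α => by
      have hu : 0 ≤ shiftSize u ^ ε := Real.rpow_nonneg (shiftSize_nonneg u) _
      filter_upwards [hdiffx u g α, hgx α] with x hx h2
      have hb := bracket_pos (x - c α)
      calc _ ≤ 2 * shiftSize u ^ ε * bracket (x - c α) ^ ε *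
            (2 * bracket (x - c α) * ‖ψ α x‖) := hx.trans (by gcongr)
        _ = _ := by rw [Real.rpow_add hb, Real.rpow_one]; ring
  obtain ⟨E, -, hE⟩ := exists_frameOp Bg Bψ
  have hcoef : ∀ φ α, ⟪ψ α, P φ⟫_ℂ = ⟪ψ α, φ⟫_ℂ := fun φ α => by
    rw [← isStarProjection_inner hP, hfix]
  refine ⟨E, ⟨8 * C ^ 2, by positivity, fun u φ => ?_⟩, fun φ => ?_, fun φ hφ => ?_,
    fun φ hφ => ?_⟩
  · -- Hölder continuity
    obtain ⟨F₁, hF₁, hF₁'⟩ := exists_frameOp (Bpg u) (Bdψ u)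
    obtain ⟨F₂, hF₂, hF₂'⟩ := exists_frameOp (Bdg u) Bψ
    -- The centering scalars cancel in each `|ph u g α⟩⟨ph u ψ α|`, so these rank-one operators
    -- still sum to the conjugate of `E`.
    have h1 : HasSum (fun α => ⟪ph u ψ α, φ⟫_ℂ • ph u g α) (phase u (E (phase (-u) φ))) := by
      have := (hE (phase (-u) φ)).mapL (phaseCLM u)
      refine this.congr_fun fun α => ?_
      have h2 : ⟪phase u (ψ α), φ⟫_ℂ = ⟪ψ α, phase (-u) φ⟫_ℂ := by
        rw [← inner_phase_phase u (ψ α) (phase (-u) φ), phase_phase_neg]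
      rw [hph, phaseCLM_apply, map_smul]
      simp only
      rw [inner_smul_left, h2, smul_smul, mul_right_comm, RCLike.conj_mul, norm_phaseFn]
      simp
    -- Telescoping: `|g_u⟩⟨ψ_u| - |g⟩⟨ψ| = |g_u⟩⟨ψ_u - ψ| + |g_u - g⟩⟨ψ|`.
    have h2 : phase u (E (phase (-u) φ)) - E φ = F₁ φ + F₂ φ := by
      refine (h1.sub (hE φ)).unique (((hF₁' φ).add (hF₂' φ)).congr_fun fun α => ?_)
      rw [Pi.sub_apply, Pi.sub_apply, inner_sub_left, sub_smul, smul_sub _ (ph u g α),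
        sub_add_sub_cancel]
    rw [h2]
    calc _ ≤ ‖F₁ φ‖ + ‖F₂ φ‖ := norm_add_le _ _
      _ ≤ C * 2 * (C * (2 * shiftSize u ^ ε)) * ‖φ‖ +
          C * (4 * shiftSize u ^ ε) * (C * 1) * ‖φ‖ :=
          add_le_add (F₁.le_of_opNorm_le hF₁ φ) (F₂.le_of_opNorm_le hF₂ φ)
      _ = _ := by ring
  · refine (hE (P φ)).unique ?_
    simpa only [hcoef] using hE φ
  · obtain ⟨F₁, -, hF₁⟩ := exists_frameOp Bψ Bψ
    obtain ⟨F₂, -, hF₂⟩ := exists_frameOp Bψ Bg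
    refine (((hF₁ (posX ⟨P φ, hφ⟩)).add (hF₂ (P φ))).congr_fun fun α => ?_).summable
    -- By symmetry of `X`, `m α ⟪ψ α, φ⟫ = ⟪ψ α, X P φ⟫ + ⟪g α, P φ⟫`, and Bessel families give a
    -- summable series for each term.
    have h1 : ⟪ψ α, posX ⟨P φ, hφ⟩⟫_ℂ = m α * ⟪ψ α, φ⟫_ℂ - ⟪g α, P φ⟫_ℂ := by
      have h2 := inner_posX ⟨ψ α, hdom α⟩ ⟨P φ, hφ⟩
      have h3 : posX ⟨ψ α, hdom α⟩ = m α • ψ α - g α := (sub_sub_cancel _ _).symm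
      simp only at h2
      rw [← h2, h3, inner_sub_left, inner_smul_left, hcoef]
      simp [hm]
    rw [← add_smul, h1, sub_add_cancel]
  · refine posX_closed (l := Filter.atTop) (f := fun F => ∑ α ∈ F, ⟪ψ α, φ⟫_ℂ • ψ α)
      (fun F => PosXRel.sum (fun α => (hXψ α).smul _) F) (hψ.hasSum hP φ) ?_
    refine ((hasSum_centerOp hφ).sub (hE φ)).congr_fun fun α => ?_
    rw [smul_sub, smul_smul, mul_comm]

/-! ### The filtered position operator -/

theorem continuous_phase_comp {X : Type*} [TopologicalSpace X] {u : X → ℝ × ℝ} {χ : X → L2}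
    (hu : Continuous u) (hχ : Continuous χ) : Continuous fun t => phase (u t) (χ t) := by
  rw [continuous_iff_continuousAt]
  intro t₀
  have h1 : Filter.Tendsto (fun t => ‖χ t - χ t₀‖) (𝓝 t₀) (𝓝 0) :=
    tendsto_iff_norm_sub_tendsto_zero.1 (hχ.tendsto t₀)
  have h2 : Filter.Tendsto (fun t => ‖phase (u t) (χ t₀) - phase (u t₀) (χ t₀)‖) (𝓝 t₀) (𝓝 0) :=
    tendsto_iff_norm_sub_tendsto_zero.1 (((continuous_phase (χ t₀)).comp hu).tendsto t₀)
  refine tendsto_iff_norm_sub_tendsto_zero.2 (squeeze_zero (fun t => norm_nonneg _) (fun t => ?_)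
    (by simpa using h1.add h2))
  rw [← norm_phase (u t) (χ t - χ t₀), map_sub]
  exact norm_sub_le_norm_sub_add_norm_sub _ _ _

theorem continuous_conj_phase (B : L2 →L[ℂ] L2) (Δ : ℝ) (φ : L2) :
    Continuous fun t : ℝ × ℝ => phase (Δ⁻¹ • t) (B (phase (-(Δ⁻¹ • t)) φ)) :=
  continuous_phase_comp (by fun_prop) (B.continuous.comp
    ((continuous_phase φ).comp (by fun_prop)))

theorem norm_conj_phase_le (B : L2 →L[ℂ] L2) (u : ℝ × ℝ) (φ : L2) :
    ‖phase u (B (phase (-u) φ))‖ ≤ ‖B‖ * ‖φ‖ := by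
  rw [norm_phase]
  exact (B.le_opNorm _).trans_eq (by rw [norm_phase])

theorem integrable_filter_conj (B : L2 →L[ℂ] L2) (Δ : ℝ) (φ : L2) :
    Integrable fun t : ℝ × ℝ =>
      filterWeight t • phase (Δ⁻¹ • t) (B (phase (-(Δ⁻¹ • t)) φ)) := by
  refine (integrable_filterWeight.norm.mul_const (‖B‖ * ‖φ‖)).mono'
    (continuous_filterWeight.smul (continuous_conj_phase B Δ φ)).aestronglyMeasurable
    (Filter.Eventually.of_forall fun t => ?_)
  rw [norm_smul]
  gcongr
  exact norm_conj_phase_le B _ φ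

/-- The difference between a bounded operator and its filtered version. -/
theorem PhaseHolder.exists_filterDefect {B : L2 →L[ℂ] L2} {ε D : ℝ} (hB : PhaseHolder B ε D)
    (hε : 0 ≤ ε) (hε1 : ε ≤ 1 / 2) {Δ : ℝ} (hΔ : 0 < Δ) :
    ∃ S : L2 →L[ℂ] L2,
      ‖S‖ ≤ D * (∫ t : ℝ × ℝ, shiftSize t ^ ε * ‖filterWeight t‖) * Δ ^ (-ε) ∧
      (∀ χ, Integrable fun t : ℝ × ℝ =>
        filterWeight t • (phase (Δ⁻¹ • t) (B (phase (-(Δ⁻¹ • t)) χ)) - B χ)) ∧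
      ∀ χ, S χ = ∫ t : ℝ × ℝ,
        filterWeight t • (phase (Δ⁻¹ • t) (B (phase (-(Δ⁻¹ • t)) χ)) - B χ) := by
  have hint : ∀ χ, Integrable fun t : ℝ × ℝ =>
      filterWeight t • (phase (Δ⁻¹ • t) (B (phase (-(Δ⁻¹ • t)) χ)) - B χ) := fun χ => by
    simp_rw [smul_sub]
    exact (integrable_filter_conj B Δ χ).sub (integrable_filterWeight.smul_const _)
  have hsize : ∀ t : ℝ × ℝ, shiftSize (Δ⁻¹ • t) ^ ε = shiftSize t ^ ε * Δ ^ (-ε) := fun t => by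
    have : shiftSize (Δ⁻¹ • t) = shiftSize t * Δ⁻¹ := by
      simp only [shiftSize, Prod.smul_fst, Prod.smul_snd, smul_eq_mul, abs_mul,
        abs_of_pos (inv_pos.2 hΔ)]
      ring
    rw [this, Real.mul_rpow (shiftSize_nonneg t) (by positivity), Real.inv_rpow hΔ.le,
      Real.rpow_neg hΔ.le]
  let S₀ : L2 →ₗ[ℂ] L2 :=
    { toFun := fun χ => ∫ t : ℝ × ℝ,
        filterWeight t • (phase (Δ⁻¹ • t) (B (phase (-(Δ⁻¹ • t)) χ)) - B χ)
      map_add' := fun φ χ => by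
        rw [← integral_add (hint φ) (hint χ)]
        refine integral_congr_ae (Filter.Eventually.of_forall fun t => ?_)
        simp only [map_add]
        module
      map_smul' := fun a φ => by
        rw [RingHom.id_apply, ← integral_smul]
        refine integral_congr_ae (Filter.Eventually.of_forall fun t => ?_)
        simp only [map_smul]
        module }
  have hw := integrable_shiftSize_rpow_mul_filterWeight hε hε1
  have hW : 0 ≤ ∫ t : ℝ × ℝ, shiftSize t ^ ε * ‖filterWeight t‖ :=
    integral_nonneg fun t => mul_nonneg (Real.rpow_nonneg (shiftSize_nonneg t) _) (norm_nonneg _)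
  have hD := hB.1
  refine ⟨S₀.mkContinuous (D * (∫ t : ℝ × ℝ, shiftSize t ^ ε * ‖filterWeight t‖) * Δ ^ (-ε))
    fun χ => ?_, LinearMap.mkContinuous_norm_le _ (by positivity) _, hint, fun χ => rfl⟩
  calc ‖S₀ χ‖ ≤ ∫ t : ℝ × ℝ, (shiftSize t ^ ε * ‖filterWeight t‖) * (D * Δ ^ (-ε) * ‖χ‖) := by
        refine norm_integral_le_of_norm_le (hw.mul_const _)
          (Filter.Eventually.of_forall fun t => ?_)
        rw [norm_smul]
        calc _ ≤ ‖filterWeight t‖ * (D * shiftSize (Δ⁻¹ • t) ^ ε * ‖χ‖) := by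
              gcongr
              exact hB.2 _ _
          _ = _ := by rw [hsize]; ring
    _ = _ := by rw [integral_mul_const]; ring

/-- The filtered version of an operator that differs from `X` by a bounded operator. -/
theorem filtered_of_eq_posX_add {A : L2 →ₗ.[ℂ] L2} {B : L2 →L[ℂ] L2}
    (hdom : A.domain = posX.domain)
    (hA : ∀ φ (h : φ ∈ A.domain) (h' : φ ∈ posX.domain), A ⟨φ, h⟩ = posX ⟨φ, h'⟩ + B φ) (Δ : ℝ) :
    (filtered A Δ).domain = posX.domain ∧
      ∀ φ (h : φ ∈ (filtered A Δ).domain) (h' : φ ∈ posX.domain), filtered A Δ ⟨φ, h⟩ =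
        posX ⟨φ, h'⟩ + ∫ t : ℝ × ℝ,
          filterWeight t • phase (Δ⁻¹ • t) (B (phase (-(Δ⁻¹ • t)) φ)) := by
  have hval : ∀ φ (h : ∀ t : ℝ × ℝ, phase (-(Δ⁻¹ • t)) φ ∈ A.domain) (h' : φ ∈ posX.domain)
      (t : ℝ × ℝ), filterIntegrand A Δ φ h t = filterWeight t • posX ⟨φ, h'⟩ +
        filterWeight t • phase (Δ⁻¹ • t) (B (phase (-(Δ⁻¹ • t)) φ)) := fun φ h h' t => by
    obtain ⟨h1, e1⟩ := phase_posX (-(Δ⁻¹ • t)) h'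
    -- `X` commutes with phases, so its conjugate is `X` itself; only `B` is really conjugated.
    rw [filterIntegrand, hA _ (h t) h1, e1, map_add, phase_phase_neg, smul_add]
    rfl
  constructor
  · ext φ
    constructor
    · rintro ⟨h, -⟩
      have := h 0
      rw [smul_zero, neg_zero, phase_zero, hdom] at this
      exact this
    · intro hφ
      have h : ∀ t : ℝ × ℝ, phase (-(Δ⁻¹ • t)) φ ∈ A.domain := fun t => by
        rw [hdom]; exact (phase_posX _ hφ).1
      refine ⟨h, ?_⟩
      refine ((integrable_filterWeight.smul_const (posX ⟨φ, hφ⟩)).add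
        (integrable_filter_conj B Δ φ)).congr (Filter.Eventually.of_forall fun t => ?_)
      exact (hval φ h hφ t).symm
  · intro φ h h'
    change ∫ t : ℝ × ℝ, filterIntegrand A Δ φ _ t = _
    rw [integral_congr_ae (Filter.Eventually.of_forall fun t => hval φ _ h' t),
      integral_add (integrable_filterWeight.smul_const _) (integrable_filter_conj B Δ φ),
      integral_smul_const, integral_filterWeight, one_smul]

/-- The filter preserves reality of quadratic forms. -/
theorem im_inner_filterDefect {B S : L2 →L[ℂ] L2} {Δ : ℝ}
    (hint : ∀ χ, Integrable fun t : ℝ × ℝ =>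
        filterWeight t • (phase (Δ⁻¹ • t) (B (phase (-(Δ⁻¹ • t)) χ)) - B χ))
    (hS : ∀ χ, S χ = ∫ t : ℝ × ℝ,
        filterWeight t • (phase (Δ⁻¹ • t) (B (phase (-(Δ⁻¹ • t)) χ)) - B χ))
    (hB : ∀ χ ∈ posX.domain, (⟪χ, B χ⟫_ℂ).im = 0) {χ : L2} (hχ : χ ∈ posX.domain) :
    (⟪χ, S χ⟫_ℂ).im = 0 := by
  rw [hS, ← integral_inner (hint χ) χ, ← Complex.imCLM_apply,
    ← Complex.imCLM.integral_comp_comm ((hint χ).const_inner χ)]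
  refine integral_eq_zero_of_ae (Filter.Eventually.of_forall fun t => ?_)
  have h1 : (filterWeight t).im = 0 := by
    rw [← Complex.conj_eq_iff_im]; exact conj_filterWeight t
  have h2 : ⟪χ, phase (Δ⁻¹ • t) (B (phase (-(Δ⁻¹ • t)) χ))⟫_ℂ =
      ⟪phase (-(Δ⁻¹ • t)) χ, B (phase (-(Δ⁻¹ • t)) χ)⟫_ℂ := by
    rw [← inner_phase_phase (Δ⁻¹ • t) (phase (-(Δ⁻¹ • t)) χ), phase_phase_neg]
  simp only [Complex.imCLM_apply, Pi.zero_apply]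
  rw [inner_smul_right, inner_sub_right, h2, Complex.mul_im, Complex.sub_im, h1,
    hB _ (phase_posX _ hχ).1, hB _ hχ]
  simp

/-! ### The diagonal operator: resolvent and quadratic form -/

theorem isSymmetricForm_centerOp {ι : Type*} (ψ : ι → L2) (c : ι → Plane) :
    IsSymmetricForm (centerOp ψ c) := fun φ => by
  have h := (hasSum_centerOp φ.2).mapL (innerSL ℂ (φ : L2))
  have h2 := h.mapL Complex.imCLM
  have h3 : HasSum (fun _ : ι => (0 : ℝ)) (⟪(φ : L2), centerOp ψ c φ⟫_ℂ).im := by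
    refine h2.congr_fun fun α => ?_
    rw [innerSL_apply_apply, inner_smul_right, mul_assoc, ← inner_conj_symm (φ : L2) (ψ α),
      RCLike.mul_conj, ← Complex.ofReal_intCast]
    simp [← Complex.ofReal_pow]
  exact h3.unique hasSum_zero

theorem IsLocalizedBasis.exists_resolvent {ι : Type*} {P : L2 →L[ℂ] L2} (hP : IsStarProjection P)
    {s : ℝ} {ψ : ι → L2} {c : ι → Plane} (hψ : IsLocalizedBasis P s ψ c) {z : ℂ}
    (hz : ∀ m : ℤ, 1 / 4 < ‖z - m‖) :
    ∃ R : L2 →L[ℂ] L2, ‖R‖ ≤ 4 + 4 * ‖1 - P‖ ∧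
      (∀ φ : (centerOp ψ c).domain, R (z • (φ : L2) - centerOp ψ c φ) = φ) ∧
      ∀ χ : L2, ∃ h : R χ ∈ (centerOp ψ c).domain, z • R χ - centerOp ψ c ⟨R χ, h⟩ = χ := by
  have hfix := hψ.apply_eq hP
  have hon := hψ.orthonormal
  set m : ι → ℂ := fun α => ((latticeX (c α) : ℤ) : ℂ) with hm
  have hne : ∀ k : ℤ, z - k ≠ 0 := fun k h => by
    have := hz k
    rw [h, norm_zero] at this
    norm_num at this
  have hz0 : z ≠ 0 := by simpa using hne 0
  have hinv : ∀ k : ℤ, ‖(z - k)⁻¹‖ ≤ 4 := fun k => by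
    rw [norm_inv]
    have := hz k
    exact inv_le_of_inv_le₀ (by norm_num) (by linarith)
  have hbes : BesselBound (fun α => (starRingEnd ℂ) ((z - m α)⁻¹) • ψ α) 4 := by
    refine ⟨by norm_num, fun F φ => ?_⟩
    calc _ ≤ ∑ α ∈ F, 4 ^ 2 * ‖⟪ψ α, φ⟫_ℂ‖ ^ 2 := by
          refine Finset.sum_le_sum fun α _ => ?_
          rw [inner_smul_left, Complex.conj_conj, norm_mul, mul_pow]
          gcongr
          exact hinv _
      _ ≤ _ := by
          rw [← Finset.mul_sum]
          gcongr
          exact hon.sum_inner_products_le φ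
  obtain ⟨F, hF, hFs⟩ := exists_frameOp (besselBound_of_orthonormal hon) hbes
  have hFs' : ∀ φ, HasSum (fun α => ((z - m α)⁻¹ * ⟪ψ α, φ⟫_ℂ) • ψ α) (F φ) := fun φ => by
    refine (hFs φ).congr_fun fun α => ?_
    rw [inner_smul_left, Complex.conj_conj]
  have hPF : ∀ φ α, ⟪ψ α, (1 - P) φ⟫_ℂ = 0 := fun φ α => by
    rw [sub_apply, one_apply_eq_self, inner_sub_right,
      ← isStarProjection_inner hP, hfix, sub_self]
  -- `F` inverts `z - m α` along the basis, and `z⁻¹` acts on the range of `1 - P`, where the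
  -- diagonal operator vanishes. Since `0` is an integer, `|z⁻¹| ≤ 4` as well.
  refine ⟨F + z⁻¹ • (1 - P), ?_, fun φ => ?_, fun χ => ?_⟩
  · refine (norm_add_le _ _).trans (add_le_add (by simpa using hF) ?_)
    rw [norm_smul]
    gcongr
    simpa using hinv 0
  · have hφ := hasSum_centerOp φ.2
    have hc := inner_of_hasSum_orthonormal hon hφ
    have h1 : F (z • (φ : L2) - centerOp ψ c φ) = P φ := by
      refine (hFs' _).unique ((hψ.hasSum hP φ).congr_fun fun α => ?_)
      rw [inner_sub_right, inner_smul_right, hc, ← sub_mul, inv_mul_cancel_left₀ (hne _)]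
    have h2 : P (centerOp ψ c φ) = centerOp ψ c φ := by
      refine (hφ.mapL P).unique (hφ.congr_fun fun α => ?_)
      rw [map_smul, hfix]
    rw [add_apply, h1, smul_apply, sub_apply, one_apply_eq_self,
      map_sub, map_smul, h2, sub_sub_sub_cancel_right, ← smul_sub, inv_smul_smul₀ hz0,
      add_sub_cancel]
  · set ξ := (F + z⁻¹ • (1 - P)) χ with hξ
    have hξ' : ξ = F χ + z⁻¹ • (1 - P) χ := rfl
    have hcoef : ∀ α, ⟪ψ α, ξ⟫_ℂ = (z - m α)⁻¹ * ⟪ψ α, χ⟫_ℂ := fun α => by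
      rw [hξ', inner_add_right, inner_smul_right, hPF, mul_zero, add_zero,
        inner_of_hasSum_orthonormal hon (hFs' χ)]
    have h1 : HasSum (fun α => (m α * ⟪ψ α, ξ⟫_ℂ) • ψ α) (z • F χ - P χ) := by
      refine (((hFs' χ).const_smul z).sub (hψ.hasSum hP χ)).congr_fun fun α => ?_
      rw [hcoef, smul_smul, ← sub_smul]
      congr 1
      have := hne (latticeX (c α))
      have h' : z - m α ≠ 0 := this
      field_simp
      ring
    obtain ⟨h, e⟩ := centerOp_of_hasSum h1
    refine ⟨h, ?_⟩
    rw [e, hξ', smul_add, smul_inv_smul₀ hz0, sub_apply,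
      one_apply_eq_self]
    abel

/-- The structure of `P X̂ P`: it is a small symmetric perturbation of the diagonal operator. -/
theorem IsLocalizedBasis.exists_decomposition {ι : Type*} {P : L2 →L[ℂ] L2}
    (hP : IsStarProjection P) {K : Plane → Plane → ℂ} (hK : HasDecayKernel P K) {s : ℝ}
    {ψ : ι → L2} {c : ι → Plane} (hψ : IsLocalizedBasis P s ψ c) {ε : ℝ} (hε : 0 ≤ ε)
    (hε1 : ε ≤ 1 / 2) (hs : 5 / 2 + ε < s) :
    ∃ C : ℝ, 0 ≤ C ∧ ∀ Δ : ℝ, 0 < Δ → ∃ T : L2 →L[ℂ] L2, ‖T‖ ≤ C * Δ ^ (-ε) ∧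
      (sandwich P (hatX P ψ c Δ)).domain = (centerOp ψ c).domain ∧
      (∀ φ (h : φ ∈ (sandwich P (hatX P ψ c Δ)).domain) (h' : φ ∈ (centerOp ψ c).domain),
        sandwich P (hatX P ψ c Δ) ⟨φ, h⟩ = centerOp ψ c ⟨φ, h'⟩ + T φ) ∧
      IsSymmetricForm (sandwich P (hatX P ψ c Δ)) := by
  obtain ⟨E, ⟨DE, hEh⟩, hEP, hEd, hEX⟩ := hψ.exists_defect hP hK hε (by linarith) hs
  obtain ⟨L, ⟨DL, hLh⟩, hL⟩ := hK.exists_commutator hε (by linarith)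
  obtain ⟨DP, hPh⟩ := hK.exists_phaseHolder hε (by linarith : ε ≤ 1)
  have hPP := isStarProjection_apply_apply hP
  have hfix := hψ.apply_eq hP
  have hLr : ∀ {φ ξ}, PosXRel φ ξ → PosXRel (P φ) (P ξ + L φ) := fun {φ ξ} ⟨h, e⟩ => by
    obtain ⟨h', e'⟩ := hL φ h
    exact ⟨h', by rw [e', e]⟩
  have hBh := hEh.add (hPh.mul hLh)
  set B : L2 →L[ℂ] L2 := E + P * L with hB
  have hBv : ∀ φ, B φ = E φ + P (L φ) := fun φ => rfl
  set A := tildeX P ψ c with hA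
  have hdomiff : ∀ φ, φ ∈ (centerOp ψ c).domain ↔ P φ ∈ posX.domain := fun φ =>
    ⟨fun h => (hEX φ h).1, hEd φ⟩
  have hAdom : A.domain = posX.domain := by
    ext φ
    constructor
    · rintro ⟨h1, h2⟩
      have h3 : (1 - P) φ ∈ posX.domain := h2
      have h4 := posX.domain.add_mem h3 ((hdomiff φ).1 h1)
      rwa [sub_apply, one_apply_eq_self, sub_add_cancel] at h4
    · intro h
      have h1 := (hL φ h).1
      exact ⟨(hdomiff φ).2 h1, posX.domain.sub_mem h h1⟩
  have hAval : ∀ φ (h : φ ∈ A.domain), A ⟨φ, h⟩ = centerOp ψ c ⟨φ, h.1⟩ +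
      (1 - P) (posX ⟨(1 - P) φ, h.2⟩) := fun φ h => rfl
  -- Add `centerOp = X P + E = P X + L + E` and `Q X Q = Q (X - P X - L) = X - P X - L + P L`.
  have hAX : ∀ φ (h : φ ∈ A.domain) (h' : φ ∈ posX.domain),
      A ⟨φ, h⟩ = posX ⟨φ, h'⟩ + B φ := fun φ h h' => by
    have hX : PosXRel φ (posX ⟨φ, h'⟩) := ⟨h', rfl⟩
    have hPX := hLr hX
    have h1 := hPX.unique (hEX φ h.1)
    have h2 : posX ⟨(1 - P) φ, h.2⟩ = posX ⟨φ, h'⟩ - (P (posX ⟨φ, h'⟩) + L φ) :=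
      PosXRel.unique ⟨h.2, rfl⟩ (hX.sub hPX)
    rw [hAval, h2, hBv, sub_apply, one_apply_eq_self, map_sub, map_add, hPP,
      eq_add_of_sub_eq h1.symm]
    abel
  -- On the domain of `X`, `B` is the difference of `X̃` and `X`, whose quadratic forms are both
  -- real.
  have hBsym : ∀ χ ∈ posX.domain, (⟪χ, B χ⟫_ℂ).im = 0 := fun χ hχ => by
    have h : χ ∈ A.domain := hAdom ▸ hχ
    have h1 : B χ = A ⟨χ, h⟩ - posX ⟨χ, hχ⟩ := by rw [hAX χ h hχ, add_sub_cancel_left]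
    have hXsym : ∀ η : posX.domain, (⟪(η : L2), posX η⟫_ℂ).im = 0 := fun η => by
      rw [← Complex.conj_eq_iff_im, inner_conj_symm, inner_posX]
    have h2 : ⟪χ, (1 - P) (posX ⟨(1 - P) χ, h.2⟩)⟫_ℂ =
        ⟪(1 - P) χ, posX ⟨(1 - P) χ, h.2⟩⟫_ℂ := by
      simp only [sub_apply, one_apply_eq_self, inner_sub_left, inner_sub_right]
      rw [isStarProjection_inner hP]
    rw [h1, hAval, inner_sub_right, inner_add_right, h2, Complex.sub_im, Complex.add_im]
    have e1 := isSymmetricForm_centerOp ψ c ⟨χ, h.1⟩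
    have e2 := hXsym ⟨(1 - P) χ, h.2⟩
    have e3 := hXsym ⟨χ, hχ⟩
    simp only at e1 e2 e3
    rw [e1, e2, e3]
    norm_num
  set W := ∫ t : ℝ × ℝ, shiftSize t ^ ε * ‖filterWeight t‖ with hW
  have hW0 : 0 ≤ W :=
    integral_nonneg fun t => mul_nonneg (Real.rpow_nonneg (shiftSize_nonneg t) _) (norm_nonneg _)
  set D := DE + (DP * ‖L‖ + ‖P‖ * DL) with hD
  have hD0 : 0 ≤ D := hBh.1
  refine ⟨‖P‖ * (D * W) * ‖P‖, by positivity, fun Δ hΔ => ?_⟩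
  obtain ⟨S, hSn, hSint, hS⟩ := hBh.exists_filterDefect hε hε1 hΔ
  obtain ⟨hfdom, hfval⟩ := filtered_of_eq_posX_add hAdom hAX Δ
  have hdom : (sandwich P (hatX P ψ c Δ)).domain = (centerOp ψ c).domain := by
    ext φ
    rw [hdomiff, ← hfdom]
    rfl
  have hval : ∀ φ (h : φ ∈ (sandwich P (hatX P ψ c Δ)).domain) (h' : φ ∈ (centerOp ψ c).domain),
      sandwich P (hatX P ψ c Δ) ⟨φ, h⟩ = centerOp ψ c ⟨φ, h'⟩ + (P * S * P) φ := fun φ h h' => by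
    obtain ⟨hX, eX⟩ := hEX φ h'
    have h1 : (∫ t : ℝ × ℝ, filterWeight t • phase (Δ⁻¹ • t) (B (phase (-(Δ⁻¹ • t)) (P φ)))) =
        S (P φ) + B (P φ) := by
      rw [hS]
      have := integral_add (hSint (P φ)) (integrable_filterWeight.smul_const (B (P φ)))
      rw [integral_smul_const, integral_filterWeight, one_smul] at this
      rw [← this]
      refine integral_congr_ae (Filter.Eventually.of_forall fun t => ?_)
      simp only
      rw [← smul_add, sub_add_cancel]
    have hm : P φ ∈ (filtered A Δ).domain := h
    have h2 : sandwich P (hatX P ψ c Δ) ⟨φ, h⟩ = P (filtered A Δ ⟨P φ, hm⟩) := rfl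
    -- A commutator with a projection has no diagonal block: apply `P` to `X P φ = P X P φ + L P φ`.
    -- Hence compressing `X̃` returns exactly `centerOp`.
    have h3 : P (L (P φ)) = 0 := by
      have h4 := hLr ⟨hX, rfl⟩
      rw [hPP] at h4
      have h5 := congrArg P (PosXRel.unique ⟨hX, rfl⟩ h4)
      rw [map_add, hPP] at h5
      exact left_eq_add.1 h5
    have h6 : P (centerOp ψ c ⟨φ, h'⟩) = centerOp ψ c ⟨φ, h'⟩ := by
      have hs := hasSum_centerOp h'
      refine (hs.mapL P).unique (hs.congr_fun fun α => ?_)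
      rw [map_smul, hfix]
    rw [h2, hfval _ hm hX, eX, h1, hBv, hEP, map_add, map_sub, h6, map_add, map_add, hPP, h3]
    simp only [mul_apply_eq_comp]
    abel
  refine ⟨P * S * P, ?_, hdom, hval, fun φ => ?_⟩
  · calc ‖P * S * P‖ ≤ ‖P‖ * ‖S‖ * ‖P‖ :=
          (norm_mul_le _ _).trans (mul_le_mul_of_nonneg_right (norm_mul_le _ _) (norm_nonneg _))
      _ ≤ ‖P‖ * (D * W * Δ ^ (-ε)) * ‖P‖ := by gcongr
      _ = _ := by ring
  · have h' : (φ : L2) ∈ (centerOp ψ c).domain := hdom ▸ φ.2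
    rw [show sandwich P (hatX P ψ c Δ) φ = sandwich P (hatX P ψ c Δ) ⟨φ, φ.2⟩ from rfl,
      hval φ φ.2 h', inner_add_right, Complex.add_im, mul_apply_eq_comp, mul_apply_eq_comp,
      ← isStarProjection_inner hP, im_inner_filterDefect hSint hS hBsym ((hdomiff _).1 h')]
    have := isSymmetricForm_centerOp ψ c ⟨φ, h'⟩
    simp only at this
    rw [this, add_zero]

end Wannier

/-! ### Choice of the Hölder exponent and of the filter threshold -/

theorem proposition7p1 {ι : Type*} (P : Wannier.L2 →L[ℂ] Wannier.L2)
    (hP : IsStarProjection P) (hker : Wannier.HasExpLocalizedKernel P)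
    (s : ℝ) (hs : 5 / 2 < s) (ψ : ι → Wannier.L2) (c : ι → Wannier.Plane)
    (hψ : Wannier.IsLocalizedBasis P s ψ c) :
    ∃ Δ₀ : ℝ, 0 < Δ₀ ∧ ∀ Δ : ℝ, Δ₀ ≤ Δ →
      (∀ l ∈ Wannier.gapSet,
        (l : ℂ) ∈ Wannier.resolventSet (Wannier.sandwich P (Wannier.hatX P ψ c Δ))) ∧
      Wannier.HasUniformSpectralGaps (Wannier.sandwich P (Wannier.hatX P ψ c Δ)) := by
  obtain ⟨K, hK⟩ := hker.exists_hasDecayKernel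
  -- `ε ≤ 1/2` keeps `|t| ^ ε` integrable against the filter, and half of the excess `s - 5/2`
  -- leaves the strict room needed by the Bessel bound.
  set ε : ℝ := min (1 / 2) ((s - 5 / 2) / 2) with hε
  have hε0 : 0 < ε := lt_min (by norm_num) (by linarith)
  have hε1 : ε ≤ 1 / 2 := min_le_left _ _
  have hεs : 5 / 2 + ε < s := by
    have := min_le_right (1 / 2) ((s - 5 / 2) / 2)
    rw [← hε] at this
    linarith
  obtain ⟨C, hC, hdec⟩ := hψ.exists_decomposition hP hK hε0.le hε1 hεs
  set r : ℝ := 4 + 4 * ‖1 - P‖ with hr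
  have hr0 : 0 < r := by positivity
  have hlim : Filter.Tendsto (fun Δ : ℝ => C * Δ ^ (-ε) * r) Filter.atTop (nhds 0) := by
    simpa using ((tendsto_rpow_neg_atTop hε0).const_mul C).mul_const r
  obtain ⟨Δ₁, hΔ₁⟩ := Filter.eventually_atTop.1 (hlim.eventually_lt_const zero_lt_one)
  -- The maximum with `1` ensures `Δ > 0`. The smallness condition uses a resolvent bound
  -- independent of `w`, so one threshold serves all points.
  refine ⟨max Δ₁ 1, by positivity, fun Δ hΔ => ?_⟩
  obtain ⟨T, hT, hdom, hval, hsym⟩ := hdec Δ (by linarith [le_max_right Δ₁ 1])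
  have hfar : ∀ w : ℂ, (∀ m : ℤ, 1 / 4 < ‖w - m‖) →
      w ∈ Wannier.resolventSet (Wannier.sandwich P (Wannier.hatX P ψ c Δ)) := fun w hw => by
    obtain ⟨R, hR, hl, hr'⟩ := hψ.exists_resolvent hP hw
    refine Wannier.mem_resolventSet_of_perturb (A := Wannier.centerOp ψ c) R T hdom hl hr'
      (fun φ h h' => ?_) ?_
    · rw [hval φ h' h, sub_add_eq_sub_sub]
    · calc ‖T‖ * ‖R‖ ≤ C * Δ ^ (-ε) * r :=
          mul_le_mul hT hR (norm_nonneg _) ((norm_nonneg _).trans hT)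
        _ < 1 := hΔ₁ Δ ((le_max_left _ _).trans hΔ)
  exact ⟨fun l hl => hfar _ (Wannier.quarter_lt_norm_sub_of_mem_gapSet hl),
    Wannier.hasUniformSpectralGaps_of_far hsym hfar⟩
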